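/- Let $2^{\mathbb N}$ be the Cantor space. A set $V\subseteq[0,1]$ is \emph{group-like} if it is countably infinite, contains $0$ and $1$, and $V+\mathbb Z$ is an additive subgroup of $\mathbb R$; a group-like set $V$ is \emph{$\mathbb Q$-like} if $V+\mathbb Z$ is a rational vector space. A Borel probability measure $\mu$ on $2^{\mathbb N}$ is \emph{good} if it is positive on all nonempty open sets and, whenever $A,B$ are clopen with $\mu(A)<\mu(B)$, there is a clopen $W\subseteq B$ with $\mu(W)=\mu(A)$; its clopen values set is $\{\mu(U): U\text{ clopen}\}$. Let $\mathrm{Homeo}(2^{\mathbb N},\mu)$ be the group of all homeomorphisms of $2^{\mathbb N}$ preserving $\mu$, with the compact-open topology. A topological group has the \emph{Rokhlin property} if it has a dense conjugacy class, and the \emph{strong Rokhlin property} if it has a conjugacy class that is a dense $G_\delta$ set. Let $V$ be a group-like set. For $a\in V\setminus\{0\}$ put $V_a=\{v/a: v\in V\}\cap[0,1]$. For every $a\in V\setminus\{0\}$ there is a good measure on $2^{\mathbb N}$ with clopen values set $V_a$; below, $\mu_a$ stands for an arbitrary such measure. Then: (1) If $V$ is $\mathbb Q$-like, then $\mathrm{Homeo}(2^{\mathbb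 N},\mu_a)$ has the strong Rokhlin property for every $a\in V\setminus\{0\}$ and every $\mu_a$. (2) If $V$ is not $\mathbb Q$-like, then for every $\varepsilon>0$ there is $a\in V\setminus\{0\}$ with $1-\varepsilon<a<1$ such that $\mathrm{Homeo}(2^{\mathbb N},\mu_a)$ does not have the Rokhlin property, for every $\mu_a$. More specifically, if $b\in V$ and an integer $n>1$ are such that $b<1$ and $\frac bn\notin V$, then for every $a\in V\cap[\frac bn,\frac1n]$ we have $na\in V\setminus\{0\}$, and $\mathrm{Homeo}(2^{\mathbb N},\mu_{na})$ does not have a dense conjugacy class, for every $\mu_{na}$. -/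

import Mathlib

open MeasureTheory Set

namespace GoodMeasures

/-- The Cantor space `2^ℕ`, the countable product of discrete two-point spaces, with its product
topology and the product (equivalently, Borel) sigma-algebra. -/
abbrev Cantor : Type := ℕ → Bool

/-- The set `V + ℤ` of real numbers. -/
def addInt (V : Set ℝ) : Set ℝ := {x | ∃ v ∈ V, ∃ k : ℤ, x = v + k}

/-- Group-like sets; by convention they are countably infinite. -/
structure GroupLike (V : Set ℝ) : Prop where
  zero_mem : (0 : ℝ) ∈ V
  one_mem : (1 : ℝ) ∈ V
  subset_Icc : V ⊆ Icc 0 1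
  isAddSubgroup : ∃ G : AddSubgroup ℝ, (G : Set ℝ) = addInt V
  countable : V.Countable
  infinite : V.Infinite

/-- `V` is `ℚ`-like: it is group-like and `V + ℤ` is a rational vector space. -/
structure QLike (V : Set ℝ) : Prop where
  groupLike : GroupLike V
  isRatSubspace : ∃ W : Submodule ℚ ℝ, (W : Set ℝ) = addInt V

/-- `V_a = {v / a : v ∈ V} ∩ [0, 1]` (used for `a ≠ 0` only). -/
def scaled (V : Set ℝ) (a : ℝ) : Set ℝ := (fun v => v / a) '' V ∩ Icc 0 1

/-- The clopen values set of a measure. -/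
def clopenValues (μ : Measure Cantor) : Set ℝ := {r | ∃ U : Set Cantor, IsClopen U ∧ μ.real U = r}

/-- Good measures: Borel probability measures that are full (positive on nonempty open sets) and
satisfy the Subset Condition. -/
structure IsGood (μ : Measure Cantor) : Prop where
  isProbabilityMeasure : IsProbabilityMeasure μ
  full : ∀ U : Set Cantor, IsOpen U → U.Nonempty → 0 < μ U
  subset_condition : ∀ U V : Set Cantor, IsClopen U → IsClopen V → μ U < μ V →
    ∃ W : Set Cantor, IsClopen W ∧ W ⊆ V ∧ μ W = μ U

/-- The usual (compact-open, equivalently uniform) topology on the group of homeomorphisms of the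
Cantor space. -/
instance instTopologicalSpaceHomeo : TopologicalSpace (Cantor ≃ₜ Cantor) :=
  TopologicalSpace.induced (fun h => (⟨h, h.continuous⟩ : C(Cantor, Cantor))) inferInstance

/-- `Homeo(2^ℕ, μ)`: the group of all homeomorphisms of the Cantor space that preserve `μ`, with
the topology inherited from the group of all homeomorphisms. -/
def Homeo (μ : Measure Cantor) : Subgroup (Cantor ≃ₜ Cantor) where
  carrier := {h | μ.map h = μ}
  one_mem' := by
    change μ.map id = μ
    exact Measure.map_id
  mul_mem' := by
    intro g h hg hh
    change μ.map (g ∘ h) = μ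
    rw [← Measure.map_map g.continuous.measurable h.continuous.measurable, hh, hg]
  inv_mem' := by
    intro h hh
    change μ.map h.symm = μ
    have hh' : μ.map h = μ := hh
    conv_lhs => rw [← hh']
    rw [Measure.map_map h.symm.continuous.measurable h.continuous.measurable]
    simp

/-- Rokhlin property: there is a dense conjugacy class. -/
def HasRokhlin (G : Type*) [Group G] [TopologicalSpace G] : Prop :=
  ∃ g : G, Dense (conjugatesOf g)

/-- Strong Rokhlin property: there is a conjugacy class that is a dense `G_δ` set. -/
def HasStrongRokhlin (G : Type*) [Group G] [TopologicalSpace G] : Prop :=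
  ∃ g : G, Dense (conjugatesOf g) ∧ IsGδ (conjugatesOf g)

end GoodMeasures

/-! A group-like `V` is `G ∩ [0,1]` for a countable dense subgroup `G` of the reals containing 1,
and `V_a` is `H ∩ [0,1]` with `H = G/a`. Everything is then a question about good measures with
values group `H`; `V` is `ℚ`-like exactly when `G` is divisible, and then so is `H`.

Existence. Cut `[0,1)` repeatedly at points of `H`, using every point of `H` eventually. Binary
addresses send Lebesgue measure to a good measure whose clopen values are those of `H`
(`exists_isGood`).

Divisible case. For a finite clopen partition, the measures of the sets "in piece `i`, sent to piece
`j`" form a circulation with values in `H`, by invariance. A circulation is a sum of cycles, so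
every element of the group agrees, up to the given partition, with any homeomorphism realizing a
certain permutation of a finer partition (`exists_approx`); no divisibility is needed so far.
Divisibility gives amalgamation (`exists_amalgam`): two permuted partitions over a common quotient
are joined by averaging their joint distribution over the orbits of the product permutation. As in a
Fraïssé construction this yields generic homeomorphisms, which have arbitrarily fine invariant
partitions and realize every possible extension. They form a dense `G_δ` set, and a back-and-forth
argument shows that they are a single conjugacy class.

Other case. Suppose `1/n` and `β` are in `H` but `β/n` is not. A dense conjugacy class contains an
element rotating `n` pieces of equal measure and an element fixing a clopen set of measure `β`.
Conjugating, one homeomorphism does both, so the rotation cuts the invariant set into `n` clopen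
parts of measure `β/n`, which is absurd (`not_hasRokhlin_of_div_notMem`). For `H = G/(na)` this
applies with `β = b/(na)`. -/

namespace GoodMeasures

/-! ### Clopen partitions as locally constant maps. -/

section LocallyConstant

theorem _root_.IsLocallyConstant.measurableSet_preimage {κ : Type*} {q : Cantor → κ}
    (hq : IsLocallyConstant q) (T : Set κ) : MeasurableSet (q ⁻¹' T) :=
  (hq T).measurableSet

theorem _root_.IsLocallyConstant.isClopen_preimage {κ : Type*} {q : Cantor → κ}
    (hq : IsLocallyConstant q) (T : Set κ) : IsClopen (q ⁻¹' T) :=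
  ⟨⟨by simpa using hq Tᶜ⟩, hq T⟩

theorem isLocallyConstant_mem {A : Set Cantor} (hA : IsClopen A) :
    IsLocallyConstant (fun x => (x ∈ A : Prop)) := by
  refine (IsLocallyConstant.iff_isOpen_fiber_apply).2 fun x => ?_
  by_cases hx : x ∈ A
  · convert hA.2 using 1
    ext y; simp [hx]
  · convert hA.compl.2 using 1
    ext y; simp [hx]

theorem real_preimage_comp_singleton {μ : Measure Cantor} [IsFiniteMeasure μ] {κ ι : Type*}
    [Fintype κ] [DecidableEq ι] {q : Cantor → κ} (hq : IsLocallyConstant q) (π : κ → ι) (i : ι) :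
    ∑ y with π y = i, μ.real (q ⁻¹' {y}) = μ.real ((π ∘ q) ⁻¹' {i}) := by
  rw [sum_measureReal_preimage_singleton]
  · congr 1; ext x; simp
  · intro y _
    exact hq.measurableSet_preimage _

theorem real_preimage_congr {μ : Measure Cantor} [IsFiniteMeasure μ] {κ : Type*} [Finite κ]
    {p q : Cantor → κ} (hp : IsLocallyConstant p) (hq : IsLocallyConstant q)
    (h : ∀ j, μ.real (p ⁻¹' {j}) = μ.real (q ⁻¹' {j})) (T : Set κ) :
    μ.real (p ⁻¹' T) = μ.real (q ⁻¹' T) := by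
  classical
  cases nonempty_fintype κ
  have key : ∀ {r : Cantor → κ}, IsLocallyConstant r →
      ∑ y with y ∈ T, μ.real (r ⁻¹' {y}) = μ.real (r ⁻¹' T) := by
    intro r hr
    rw [sum_measureReal_preimage_singleton]
    · congr 1; ext x; simp
    · exact fun y _ => hr.measurableSet_preimage _
  rw [← key hp, ← key hq]
  exact Finset.sum_congr rfl fun j _ => h j

theorem eq_of_forall_isClopen {x y : Cantor} (h : ∀ A : Set Cantor, IsClopen A → (x ∈ A ↔ y ∈ A)) :
    x = y := by
  by_contra hne
  obtain ⟨A, hA, hx, hy⟩ := exists_isClopen_of_totally_separated hne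
  exact hy ((h A hA).1 hx)

theorem continuous_of_isClopen_preimage {f : Cantor → Cantor}
    (h : ∀ A : Set Cantor, IsClopen A → IsOpen (f ⁻¹' A)) : Continuous f :=
  (isTopologicalBasis_isClopen (X := Cantor)).continuous_iff.2 h

theorem map_eq_of_isClopen {μ : Measure Cantor} [IsFiniteMeasure μ] {f : Cantor → Cantor}
    (hf : Continuous f) (h : ∀ A : Set Cantor, IsClopen A → μ.real (f ⁻¹' A) = μ.real A) :
    μ.map f = μ := by
  have key : ∀ A : Set Cantor, IsClopen A → μ.map f A = μ A := by
    intro A hA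
    rw [Measure.map_apply hf.measurable hA.2.measurableSet]
    exact (measureReal_eq_measureReal_iff).1 (h A hA)
  refine ext_of_generate_finite {s : Set Cantor | IsClopen s} ?_ ?_ key (key _ isClopen_univ)
  · rw [← (isTopologicalBasis_isClopen (X := Cantor)).borel_eq_generateFrom]
    exact BorelSpace.measurable_eq
  · exact fun s hs t ht _ => IsClopen.inter hs ht

theorem Homeo.real_preimage {μ : Measure Cantor} {f : Cantor ≃ₜ Cantor} (hf : f ∈ Homeo μ)
    {A : Set Cantor} (hA : MeasurableSet A) : μ.real (f ⁻¹' A) = μ.real A := by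
  have h : μ.map f = μ := hf
  conv_rhs => rw [← h]
  rw [map_measureReal_apply f.continuous.measurable hA]

end LocallyConstant

/-! ### Refining partitions with prescribed measures. -/

section Refinement

variable {μ : Measure Cantor} {H : AddSubgroup ℝ}

theorem real_mem (hv : clopenValues μ = (H : Set ℝ) ∩ Icc 0 1) {A : Set Cantor} (hA : IsClopen A) :
    μ.real A ∈ H := by
  have : μ.real A ∈ clopenValues μ := ⟨A, hA, rfl⟩
  rw [hv] at this
  exact this.1

theorem IsGood.real_pos (hμ : IsGood μ) {A : Set Cantor} (hA : IsOpen A) (hne : A.Nonempty) :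
    0 < μ.real A := by
  have := hμ.isProbabilityMeasure
  exact ENNReal.toReal_pos (hμ.full A hA hne).ne' (measure_ne_top _ _)

theorem IsGood.exists_isClopen_subset (hμ : IsGood μ) (hv : clopenValues μ = (H : Set ℝ) ∩ Icc 0 1)
    {C : Set Cantor} (hC : IsClopen C) {h : ℝ} (hh : h ∈ H) (h0 : 0 ≤ h) (hle : h ≤ μ.real C) :
    ∃ W, IsClopen W ∧ W ⊆ C ∧ μ.real W = h := by
  have := hμ.isProbabilityMeasure
  rcases hle.eq_or_lt with rfl | hlt
  · exact ⟨C, hC, Subset.rfl, rfl⟩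
  · have : h ∈ clopenValues μ := by
      rw [hv]; exact ⟨hh, h0, hle.trans measureReal_le_one⟩
    obtain ⟨U, hU, rfl⟩ := this
    obtain ⟨W, hW, hWC, hWU⟩ := hμ.subset_condition U C hU hC
      ((ENNReal.toReal_lt_toReal (measure_ne_top _ _) (measure_ne_top _ _)).1 hlt)
    exact ⟨W, hW, hWC, by simp [measureReal_def, hWU]⟩

/-- The pieces are cut off one at a time by the subset condition; what is left has exactly the
measure needed for the remaining weights. -/
theorem IsGood.exists_partition (hμ : IsGood μ) (hv : clopenValues μ = (H : Set ℝ) ∩ Icc 0 1)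
    {κ : Type*} [DecidableEq κ] (w : κ → ℝ) (s : Finset κ) (hw : ∀ j ∈ s, 0 ≤ w j ∧ w j ∈ H) :
    ∀ C : Set Cantor, IsClopen C → ∑ j ∈ s, w j = μ.real C →
      ∃ W : κ → Set Cantor, (∀ j ∈ s, IsClopen (W j) ∧ W j ⊆ C ∧ μ.real (W j) = w j) ∧
        ∀ x ∈ C, ∃! j, j ∈ s ∧ x ∈ W j := by
  have := hμ.isProbabilityMeasure
  induction s using Finset.induction_on with
  | empty =>
    intro C hC hsum
    refine ⟨fun _ => ∅, by simp, fun x hx => ?_⟩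
    -- With no weights left `C` has measure zero, hence is empty because the measure is full.
    have := hμ.real_pos hC.2 ⟨x, hx⟩
    simp at hsum
    linarith
  | insert a s ha ih =>
    intro C hC hsum
    rw [Finset.sum_insert ha] at hsum
    have hs0 : 0 ≤ ∑ j ∈ s, w j :=
      Finset.sum_nonneg fun j hj => (hw j (Finset.mem_insert_of_mem hj)).1
    obtain ⟨A, hA, hAC, hAw⟩ := hμ.exists_isClopen_subset hv hC
      (hw a (Finset.mem_insert_self _ _)).2 (hw a (Finset.mem_insert_self _ _)).1
      (by linarith)
    obtain ⟨W, hW, hWu⟩ := ih (fun j hj => hw j (Finset.mem_insert_of_mem hj)) (C \ A)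
      (hC.diff hA) (by rw [measureReal_sdiff hAC hA.2.measurableSet]; linarith)
    refine ⟨Function.update W a A, ?_, ?_⟩
    · intro j hj
      by_cases hja : j = a
      · subst hja; simp [hA, hAC, hAw]
      · have := hW j (Finset.mem_of_mem_insert_of_ne hj hja)
        simpa [Function.update_of_ne hja] using ⟨this.1, this.2.1.trans sdiff_subset, this.2.2⟩
    · intro x hx
      by_cases hxA : x ∈ A
      · refine ⟨a, by simp [hxA], ?_⟩
        rintro j ⟨hj, hxj⟩
        by_contra hja
        rw [Function.update_of_ne hja] at hxj
        exact ((hW j (Finset.mem_of_mem_insert_of_ne hj hja)).2.1 hxj).2 hxA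
      · obtain ⟨j, ⟨hj, hxj⟩, huniq⟩ := hWu x ⟨hx, hxA⟩
        have hja : j ≠ a := fun h => ha (h ▸ hj)
        refine ⟨j, ⟨Finset.mem_insert_of_mem hj, by rwa [Function.update_of_ne hja]⟩, ?_⟩
        rintro k ⟨hk, hxk⟩
        by_cases hka : k = a
        · subst hka; simp at hxk; exact absurd hxk hxA
        · rw [Function.update_of_ne hka] at hxk
          exact huniq k ⟨Finset.mem_of_mem_insert_of_ne hk hka, hxk⟩

/-- This is how goodness is used from here on: a refinement exists as soon as its weights lie in `H`
and add up correctly. Each fibre of `p` is partitioned separately. -/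
theorem IsGood.exists_refinement (hμ : IsGood μ) (hv : clopenValues μ = (H : Set ℝ) ∩ Icc 0 1)
    {ι κ : Type*} [DecidableEq ι] [Fintype κ] {p : Cantor → ι} (hp : IsLocallyConstant p)
    (π : κ → ι) (w : κ → ℝ) (hw0 : ∀ j, 0 ≤ w j) (hwH : ∀ j, w j ∈ H)
    (hsum : ∀ i, ∑ j with π j = i, w j = μ.real (p ⁻¹' {i})) :
    ∃ q : Cantor → κ, IsLocallyConstant q ∧ π ∘ q = p ∧ ∀ j, μ.real (q ⁻¹' {j}) = w j := by
  classical
  choose W hW hWu using fun i => hμ.exists_partition hv w (Finset.univ.filter (π · = i))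
    (fun j _ => ⟨hw0 j, hwH j⟩) (p ⁻¹' {i}) (hp.isClopen_fiber i) (hsum i)
  have hex : ∀ x, ∃! j, π j = p x ∧ x ∈ W (p x) j := by
    intro x
    simpa using hWu (p x) x rfl
  choose q hq hqu using hex
  have hfib : ∀ j, q ⁻¹' {j} = W (π j) j := by
    intro j
    ext x
    simp only [mem_preimage, mem_singleton_iff]
    constructor
    · rintro rfl
      rw [(hq x).1]; exact (hq x).2
    · intro hx
      have hpx : p x = π j := (hW (π j) j (by simp)).2.1 hx
      exact (hqu x j ⟨hpx.symm, by rw [hpx]; exact hx⟩).symm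
  refine ⟨q, IsLocallyConstant.iff_isOpen_fiber.2 fun j => ?_, funext fun x => (hq x).1, fun j => ?_⟩
  · rw [hfib]; exact (hW _ j (by simp)).1.2
  · rw [hfib]; exact (hW _ j (by simp)).2.2

end Refinement

/-! ### Back-and-forth for partitions, and homogeneity. -/

section BackAndForth

/-- Two finite clopen partitions of the Cantor space, with the same labels, whose corresponding
pieces have the same measure. -/
structure PartitionPair (μ : Measure Cantor) where
  κ : Type
  finite : Finite κ
  p : Cantor → κ
  p' : Cantor → κ
  isLocallyConstant : IsLocallyConstant p
  isLocallyConstant' : IsLocallyConstant p'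
  real_eq : ∀ j, μ.real (p ⁻¹' {j}) = μ.real (p' ⁻¹' {j})

namespace PartitionPair

variable {μ : Measure Cantor}

instance : Preorder (PartitionPair μ) where
  le P Q := ∃ ρ : Q.κ → P.κ, P.p = ρ ∘ Q.p ∧ P.p' = ρ ∘ Q.p'
  le_refl P := ⟨id, rfl, rfl⟩
  le_trans P Q R := by
    rintro ⟨ρ, h, h'⟩ ⟨ρ', k, k'⟩
    exact ⟨ρ ∘ ρ', by rw [h, k]; rfl, by rw [h', k']; rfl⟩

/-- Exchange the two partitions. -/
def swap (P : PartitionPair μ) : PartitionPair μ :=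
  ⟨P.κ, P.finite, P.p', P.p, P.isLocallyConstant', P.isLocallyConstant, fun j => (P.real_eq j).symm⟩

theorem swap_le_swap {P Q : PartitionPair μ} (h : P ≤ Q) : P.swap ≤ Q.swap := by
  obtain ⟨ρ, h, h'⟩ := h
  exact ⟨ρ, h', h⟩

/-- Compactness: the fibres are nested and closed, and each is nonempty because it has the same
positive measure as the fibre through `x` on the other side. -/
theorem exists_point (hμ : IsGood μ) {s : ℕ → PartitionPair μ} (hs : Monotone s) (x : Cantor) :
    ∃ y, ∀ n, (s n).p' y = (s n).p x := by
  have := IsCompact.nonempty_iInter_of_sequence_nonempty_isCompact_isClosed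
    (fun n => (s n).p' ⁻¹' {(s n).p x}) ?_ ?_ ?_ ?_
  · obtain ⟨y, hy⟩ := this
    exact ⟨y, fun n => mem_iInter.1 hy n⟩
  · intro n y hy
    obtain ⟨ρ, h, h'⟩ := hs n.le_succ
    simp only [mem_preimage, mem_singleton_iff] at hy ⊢
    rw [h, h', Function.comp_apply, Function.comp_apply, hy]
  · intro n
    have h := hμ.real_pos ((s n).isLocallyConstant {(s n).p x}) ⟨x, rfl⟩
    rw [(s n).real_eq] at h
    exact nonempty_of_measureReal_ne_zero h.ne'
  · exact ((s 0).isLocallyConstant'.isClosed_fiber _).isCompact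
  · exact fun n => (s n).isLocallyConstant'.isClosed_fiber _

theorem exists_homeo (hμ : IsGood μ) {s : ℕ → PartitionPair μ} (hs : Monotone s)
    (h : ∀ A : Set Cantor, IsClopen A → ∃ n T, A = (s n).p ⁻¹' T)
    (h' : ∀ A : Set Cantor, IsClopen A → ∃ n T, A = (s n).p' ⁻¹' T) :
    ∃ f ∈ Homeo μ, ∀ n, (s n).p' ∘ f = (s n).p := by
  have := hμ.isProbabilityMeasure
  choose f hf using exists_point hμ hs
  choose g hg using exists_point hμ (s := fun n => (s n).swap) fun m n hmn => swap_le_swap (hs hmn)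
  have hg' : ∀ y n, (s n).p (g y) = (s n).p' y := hg
  have hfA : ∀ n T, f ⁻¹' ((s n).p' ⁻¹' T) = (s n).p ⁻¹' T := fun n T => by ext x; simp [hf]
  have hgA : ∀ n T, g ⁻¹' ((s n).p ⁻¹' T) = (s n).p' ⁻¹' T := fun n T => by ext x; simp [hg']
  let F : Cantor ≃ₜ Cantor :=
    { toFun := f
      invFun := g
      left_inv := fun x => eq_of_forall_isClopen fun A hA => by
        obtain ⟨n, T, rfl⟩ := h A hA
        simp [hf, hg']
      right_inv := fun x => eq_of_forall_isClopen fun A hA => by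
        obtain ⟨n, T, rfl⟩ := h' A hA
        simp [hf, hg']
      continuous_toFun := continuous_of_isClopen_preimage fun A hA => by
        obtain ⟨n, T, rfl⟩ := h' A hA
        rw [hfA]; exact (s n).isLocallyConstant T
      continuous_invFun := continuous_of_isClopen_preimage fun A hA => by
        obtain ⟨n, T, rfl⟩ := h A hA
        rw [hgA]; exact (s n).isLocallyConstant' T }
  refine ⟨F, map_eq_of_isClopen F.continuous fun A hA => ?_, fun n => funext fun x => hf x n⟩
  obtain ⟨n, T, rfl⟩ := h' A hA
  have := (s n).finite
  change μ.real (f ⁻¹' _) = _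
  rw [hfA]
  exact real_preimage_congr (s n).isLocallyConstant (s n).isLocallyConstant' (s n).real_eq T

end PartitionPair

/-- Countably many requirements are met one after another. Each is only claimed at some stage, so
`D` need not persist under refinement. -/
theorem exists_monotone_seq {P ι : Type*} [Preorder P] [Countable ι] (Adm : P → Prop)
    (D : ι → P → Prop) (hD : ∀ i p, Adm p → ∃ q, p ≤ q ∧ Adm q ∧ D i q) {p : P} (hp : Adm p) :
    ∃ s : ℕ → P, Monotone s ∧ s 0 = p ∧ (∀ n, Adm (s n)) ∧ ∀ i, ∃ n, D i (s n) := by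
  rcases isEmpty_or_nonempty ι with hι | hι
  · exact ⟨fun _ => p, monotone_const, rfl, fun _ => hp, fun i => isEmptyElim i⟩
  obtain ⟨e, he⟩ := exists_surjective_nat ι
  choose F hF hA hDF using hD
  let s : ℕ → {p // Adm p} := fun n =>
    Nat.rec ⟨p, hp⟩ (fun n q => ⟨F (e n) q.1 q.2, hA _ _ _⟩) n
  refine ⟨fun n => (s n).1, monotone_nat_of_le_succ fun n => hF (e n) _ (s n).2, rfl,
    fun n => (s n).2, fun i => ?_⟩
  obtain ⟨n, rfl⟩ := he i
  exact ⟨n + 1, hDF (e n) _ (s n).2⟩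

instance countable_isClopen : Countable {A : Set Cantor // IsClopen A} := by
  have : Countable (TopologicalSpace.Clopens Cantor) :=
    TopologicalSpace.Clopens.countable_iff_secondCountable.2 inferInstance
  exact Function.Injective.countable
    (f := fun A : {A : Set Cantor // IsClopen A} => (⟨A.1, A.2⟩ : TopologicalSpace.Clopens Cantor))
    fun A B h => Subtype.ext (congrArg TopologicalSpace.Clopens.carrier h)

/-- `Adm` is what the finite stages preserve. The admissible stages returned at the end see every
clopen set on the target side, so identities checked on stages pass to the limit `f`. -/
theorem PartitionPair.backAndForth {μ : Measure Cantor} (hμ : IsGood μ)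
    (Adm : PartitionPair μ → Prop)
    (forth : ∀ P, Adm P → ∀ A : Set Cantor, IsClopen A →
      ∃ Q, P ≤ Q ∧ Adm Q ∧ ∃ T, A = Q.p ⁻¹' T)
    (back : ∀ P, Adm P → ∀ A : Set Cantor, IsClopen A →
      ∃ Q, P ≤ Q ∧ Adm Q ∧ ∃ T, A = Q.p' ⁻¹' T)
    {P : PartitionPair μ} (hP : Adm P) :
    ∃ f ∈ Homeo μ, P.p' ∘ f = P.p ∧ ∀ A : Set Cantor, IsClopen A →
      ∃ Q, Adm Q ∧ Q.p' ∘ f = Q.p ∧ ∃ T, A = Q.p' ⁻¹' T := by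
  obtain ⟨s, hs, h0, hAdm, hD⟩ := exists_monotone_seq
    (ι := {A : Set Cantor // IsClopen A} ⊕ {A : Set Cantor // IsClopen A}) Adm
    (fun i Q => Sum.elim (fun A => ∃ T, A.1 = Q.p ⁻¹' T) (fun A => ∃ T, A.1 = Q.p' ⁻¹' T) i)
    (by rintro (A | A) P hP
        · exact forth P hP A.1 A.2
        · exact back P hP A.1 A.2) hP
  obtain ⟨f, hf, hfs⟩ := exists_homeo hμ hs (fun A hA => hD (.inl ⟨A, hA⟩))
    (fun A hA => hD (.inr ⟨A, hA⟩))
  refine ⟨f, hf, by rw [← h0]; exact hfs 0, fun A hA => ?_⟩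
  obtain ⟨n, hn⟩ := hD (.inr ⟨A, hA⟩)
  exact ⟨s n, hAdm n, hfs n, hn⟩

variable {μ : Measure Cantor} {H : AddSubgroup ℝ}

/-- Split the first partition by `A`, then copy the resulting measures to the second side. -/
theorem PartitionPair.exists_forth (hμ : IsGood μ) (hv : clopenValues μ = (H : Set ℝ) ∩ Icc 0 1)
    (P : PartitionPair μ) {A : Set Cantor} (hA : IsClopen A) :
    ∃ Q, P ≤ Q ∧ ∃ T, A = Q.p ⁻¹' T := by
  classical
  have := hμ.isProbabilityMeasure
  have := P.finite
  cases nonempty_fintype P.κ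
  let q : Cantor → P.κ × Prop := fun x => (P.p x, x ∈ A)
  have hq : IsLocallyConstant q := P.isLocallyConstant.prodMk (isLocallyConstant_mem hA)
  obtain ⟨q', hq', hπ, hw⟩ := hμ.exists_refinement hv P.isLocallyConstant' Prod.fst
    (fun j => μ.real (q ⁻¹' {j})) (fun _ => measureReal_nonneg)
    (fun j => real_mem hv (hq.isClopen_fiber j))
    (fun i => (real_preimage_comp_singleton hq Prod.fst i).trans (P.real_eq i))
  exact ⟨⟨P.κ × Prop, inferInstance, q, q', hq, hq', fun j => (hw j).symm⟩,
    ⟨Prod.fst, rfl, hπ.symm⟩, {z | z.2}, by ext x; simp [q]⟩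

/-- Homogeneity of good measures. -/
theorem IsGood.exists_homeo_comp_eq (hμ : IsGood μ) (hv : clopenValues μ = (H : Set ℝ) ∩ Icc 0 1)
    {κ : Type} [Finite κ] {p p' : Cantor → κ} (hp : IsLocallyConstant p)
    (hp' : IsLocallyConstant p') (h : ∀ j, μ.real (p ⁻¹' {j}) = μ.real (p' ⁻¹' {j})) :
    ∃ f ∈ Homeo μ, p' ∘ f = p := by
  obtain ⟨f, hf, hfp, -⟩ := PartitionPair.backAndForth hμ (fun _ => True)
    (fun P _ A hA => by
      obtain ⟨Q, hPQ, hQ⟩ := P.exists_forth hμ hv hA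
      exact ⟨Q, hPQ, trivial, hQ⟩)
    (fun P _ A hA => by
      obtain ⟨Q, hPQ, hQ⟩ := P.swap.exists_forth hμ hv hA
      exact ⟨Q.swap, PartitionPair.swap_le_swap hPQ, trivial, hQ⟩)
    (P := ⟨κ, inferInstance, p, p', hp, hp', h⟩) trivial
  exact ⟨f, hf, hfp⟩

end BackAndForth

/-! ### Marginals of a joint partition. -/

section Marginals

variable {α β : Type*} [Fintype α] [Fintype β]

theorem sum_filter_fst [DecidableEq α] (f : α × β → ℝ) (i : α) : ∑ z with z.1 = i, f z = ∑ j, f (i, j) := by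
  rw [Finset.sum_filter, Fintype.sum_prod_type, Finset.sum_eq_single i] <;> simp +contextual

theorem sum_filter_snd [DecidableEq β] (f : α × β → ℝ) (j : β) : ∑ z with z.2 = j, f z = ∑ i, f (i, j) := by
  rw [Finset.sum_filter, Fintype.sum_prod_type_right, Finset.sum_eq_single j] <;> simp +contextual

variable {μ : Measure Cantor} [IsFiniteMeasure μ] {r : Cantor → α × β}

theorem sum_real_fiber_fst [DecidableEq α] (hr : IsLocallyConstant r) (i : α) :
    ∑ j, μ.real (r ⁻¹' {(i, j)}) = μ.real ((Prod.fst ∘ r) ⁻¹' {i}) := by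
  rw [← real_preimage_comp_singleton hr, sum_filter_fst]

theorem sum_real_fiber_snd [DecidableEq β] (hr : IsLocallyConstant r) (j : β) :
    ∑ i, μ.real (r ⁻¹' {(i, j)}) = μ.real ((Prod.snd ∘ r) ⁻¹' {j}) := by
  rw [← real_preimage_comp_singleton hr, sum_filter_snd]

end Marginals

/-! ### Decomposing circulations into cycles. -/

section Circulation

theorem exists_mem_periodicPts {α : Type*} [Finite α] (f : α → α) (x : α) :
    ∃ n, f^[n] x ∈ Function.periodicPts f := by
  obtain ⟨m, n, hmn, h⟩ := Finite.exists_ne_map_eq_of_infinite (fun n : ℕ => f^[n] x)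
  wlog hlt : m < n generalizing m n
  · exact this n m hmn.symm h.symm (by omega)
  refine ⟨m, Function.mk_mem_periodicPts (n := n - m) (by omega) ?_⟩
  change f^[n - m] (f^[m] x) = f^[m] x
  rw [← Function.iterate_add_apply, Nat.sub_add_cancel hlt.le]
  exact h.symm

/-- A nonzero circulation contains a union of disjoint cycles of positive weight. -/
theorem exists_subcirculation {ι : Type} [Fintype ι] {M : ι → ι → ℝ} (h0 : ∀ i j, 0 ≤ M i j)
    (hbal : ∀ i, ∑ j, M i j = ∑ j, M j i) (hM : ∃ i j, M i j ≠ 0) :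
    ∃ (κ : Type) (_ : Fintype κ) (_ : Nonempty κ) (e : Equiv.Perm κ) (u : κ → ι),
      Function.Injective u ∧ ∀ x, 0 < M (u x) (u (e x)) := by
  classical
  let T := {i : ι // ∃ j, M i j ≠ 0}
  -- By balance, a vertex reached by a positive edge has a positive outgoing edge. Choosing
  -- successors gives a self-map of a finite set, which permutes its periodic points.
  have hnext : ∀ i : T, ∃ j : T, 0 < M i j := by
    rintro ⟨i, j, hij⟩
    have hpos : 0 < M i j := lt_of_le_of_ne (h0 i j) hij.symm
    have hj : 0 < ∑ k, M j k := by
      rw [hbal]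
      exact hpos.trans_le
        (Finset.single_le_sum (f := fun k => M k j) (fun k _ => h0 k j) (Finset.mem_univ i))
    obtain ⟨k, -, hk⟩ := Finset.exists_ne_zero_of_sum_ne_zero hj.ne'
    exact ⟨⟨j, k, hk⟩, hpos⟩
  choose f hf using hnext
  obtain ⟨i, j, hij⟩ := hM
  obtain ⟨n, hn⟩ := exists_mem_periodicPts f ⟨i, j, hij⟩
  refine ⟨Function.periodicPts f, inferInstance, ⟨⟨_, hn⟩⟩,
    (Function.bijOn_periodicPts f).equiv f, fun x => x.1.1,
    fun x y h => Subtype.ext (Subtype.ext h), fun x => hf x.1⟩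

/-- Induction on the size of the support: subtracting the least weight along disjoint cycles stays
in `H` and kills an edge. An element `x` of `κ` stands for one step of a cycle, from `ρ x` to `ρ (τ
x)`. -/
theorem exists_perm_of_circulation (H : AddSubgroup ℝ) {ι : Type} [Fintype ι] [DecidableEq ι]
    (n : ℕ) : ∀ M : ι → ι → ℝ, {z : ι × ι | M z.1 z.2 ≠ 0}.ncard = n → (∀ i j, 0 ≤ M i j) →
      (∀ i j, M i j ∈ H) → (∀ i, ∑ j, M i j = ∑ j, M j i) →
      ∃ (κ : Type) (_ : Fintype κ) (τ : Equiv.Perm κ) (ρ : κ → ι) (w : κ → ℝ),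
        (∀ x, 0 ≤ w x) ∧ (∀ x, w x ∈ H) ∧ (∀ x, w (τ x) = w x) ∧
        ∀ i j, ∑ x, (if ρ x = i ∧ ρ (τ x) = j then w x else 0) = M i j := by
  classical
  induction n using Nat.strong_induction_on with
  | _ n ih =>
  intro M hn h0 hH hbal
  by_cases hM : ∃ i j, M i j ≠ 0
  swap
  · push Not at hM
    exact ⟨Empty, inferInstance, 1, Empty.elim, Empty.elim, by simp, by simp, by simp, by simp [hM]⟩
  obtain ⟨T, _, _, e, u, hu, hpos⟩ := exists_subcirculation h0 hbal hM
  obtain ⟨x₀, hx₀⟩ := Finite.exists_min fun x => M (u x) (u (e x))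
  set c := M (u x₀) (u (e x₀)) with hc
  let N : ι → ι → ℝ := fun i j => ∑ x, if u x = i ∧ u (e x) = j then c else 0
  have hN : ∀ x, N (u x) (u (e x)) = c := by
    intro x
    change ∑ _, _ = _
    rw [Finset.sum_eq_single x]
    · simp
    · intro y _ hyx
      rw [if_neg fun h => hyx (hu h.1)]
    · simp
  have hN0 : ∀ i j, (¬ ∃ x, u x = i ∧ u (e x) = j) → N i j = 0 := by
    intro i j h
    push Not at h
    exact Finset.sum_eq_zero fun x _ => if_neg fun hx => h x hx.1 hx.2
  have hNle : ∀ i j, N i j ≤ M i j := by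
    intro i j
    by_cases h : ∃ x, u x = i ∧ u (e x) = j
    · obtain ⟨x, rfl, rfl⟩ := h
      rw [hN]; exact hx₀ x
    · rw [hN0 i j h]; exact h0 i j
  have hNH : ∀ i j, N i j ∈ H := by
    intro i j
    refine H.sum_mem fun x _ => ?_
    split_ifs
    · exact hH _ _
    · exact H.zero_mem
  have hNbal : ∀ i, ∑ j, N i j = ∑ j, N j i := by
    intro i
    have h1 : ∑ j, N i j = ∑ x, if u x = i then c else 0 := by
      rw [Finset.sum_comm]
      refine Finset.sum_congr rfl fun x _ => ?_
      by_cases hx : u x = i <;> simp [hx]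
    have h2 : ∑ j, N j i = ∑ x, if u (e x) = i then c else 0 := by
      rw [Finset.sum_comm]
      refine Finset.sum_congr rfl fun x _ => ?_
      by_cases hx : u (e x) = i <;> simp [hx]
    rw [h1, h2]
    exact (Equiv.sum_comp e fun x => if u x = i then c else 0).symm
  have hlt : {z : ι × ι | M z.1 z.2 - N z.1 z.2 ≠ 0}.ncard < n := by
    rw [← hn]
    refine Set.ncard_lt_ncard ⟨?_, ?_⟩ (Set.toFinite _)
    · intro z hz hz'
      have h1 := hNle z.1 z.2
      have h2 : 0 ≤ N z.1 z.2 := Finset.sum_nonneg fun x _ => by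
        split_ifs
        · exact h0 _ _
        · exact le_rfl
      exact hz (by linarith)
    · intro h
      have : (u x₀, u (e x₀)) ∈ {z : ι × ι | M z.1 z.2 ≠ 0} := (hpos x₀).ne'
      exact h this (by simp [hN, hc])
  obtain ⟨κ, _, τ, ρ, w, hw0, hwH, hwτ, hw⟩ := ih _ hlt (fun i j => M i j - N i j) rfl
    (fun i j => sub_nonneg.2 (hNle i j)) (fun i j => H.sub_mem (hH i j) (hNH i j))
    (fun i => by simp [Finset.sum_sub_distrib, hbal i, hNbal i])
  refine ⟨κ ⊕ T, inferInstance, Equiv.sumCongr τ e, Sum.elim ρ u, Sum.elim w fun _ => c,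
    ?_, ?_, ?_, ?_⟩
  · rintro (x | x)
    · exact hw0 x
    · exact h0 _ _
  · rintro (x | x)
    · exact hwH x
    · exact hH _ _
  · rintro (x | x)
    · exact hwτ x
    · rfl
  · intro i j
    rw [Fintype.sum_sum_type]
    have := hw i j
    simp only [Sum.elim_inl, Sum.elim_inr, Equiv.sumCongr_apply, Sum.map_inl, Sum.map_inr]
    rw [this]
    exact sub_add_cancel _ _

end Circulation

/-! ### Permuted partitions: approximation and amalgamation. -/

section PeriodicPartition

/-- A finite clopen partition of the Cantor space together with a permutation of its pieces that
preserves their measures. -/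
structure PeriodicPartition (μ : Measure Cantor) where
  κ : Type
  finite : Finite κ
  p : Cantor → κ
  σ : Equiv.Perm κ
  isLocallyConstant : IsLocallyConstant p
  real_eq : ∀ j, μ.real (p ⁻¹' {σ j}) = μ.real (p ⁻¹' {j})

namespace PeriodicPartition

variable {μ : Measure Cantor} {H : AddSubgroup ℝ}

/-- The pair of partitions whose realizations by homeomorphisms are the realizations of the
permutation of a periodic partition. -/
def toPair (P : PeriodicPartition μ) : PartitionPair μ :=
  ⟨P.κ, P.finite, P.σ ∘ P.p, P.p, P.isLocallyConstant.comp P.σ, P.isLocallyConstant, fun j => by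
    rw [preimage_comp, ← Equiv.image_symm_eq_preimage, image_singleton, ← P.real_eq]
    simp⟩

instance : Preorder (PeriodicPartition μ) := Preorder.lift toPair

theorem le_iff {P Q : PeriodicPartition μ} :
    P ≤ Q ↔ ∃ ρ : Q.κ → P.κ, P.σ ∘ P.p = ρ ∘ Q.σ ∘ Q.p ∧ P.p = ρ ∘ Q.p := Iff.rfl

/-- The transition matrix of `g` has equal row and column sums because `g` preserves `μ`. Its cycle
decomposition gives the weights of a refinement of `r`, and the cycles give the permutation. -/
theorem exists_approx (hμ : IsGood μ) (hv : clopenValues μ = (H : Set ℝ) ∩ Icc 0 1)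
    {g : Cantor ≃ₜ Cantor} (hg : g ∈ Homeo μ) {ι : Type} [Finite ι] {p : Cantor → ι}
    (hp : IsLocallyConstant p) :
    ∃ (Q : PeriodicPartition μ) (ρ : Q.κ → ι), p = ρ ∘ Q.p ∧ p ∘ g = ρ ∘ Q.σ ∘ Q.p := by
  classical
  have := hμ.isProbabilityMeasure
  cases nonempty_fintype ι
  have hpg : IsLocallyConstant (p ∘ g) := hp.comp_continuous g.continuous
  let r : Cantor → ι × ι := fun x => (p x, p (g x))
  have hr : IsLocallyConstant r := hp.prodMk hpg
  let M : ι → ι → ℝ := fun i j => μ.real (r ⁻¹' {(i, j)})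
  have hrow : ∀ i, ∑ j, M i j = μ.real (p ⁻¹' {i}) := fun i => sum_real_fiber_fst hr i
  have hcol : ∀ i, ∑ j, M j i = μ.real (p ⁻¹' {i}) := by
    intro i
    rw [← Homeo.real_preimage hg (hp.measurableSet_preimage _)]
    exact sum_real_fiber_snd hr i
  obtain ⟨κ, _, τ, ρ, w, hw0, hwH, hwτ, hw⟩ := exists_perm_of_circulation H _ M rfl
    (fun _ _ => measureReal_nonneg) (fun i j => real_mem hv (hr.isClopen_fiber _))
    (fun i => by rw [hrow, hcol])
  obtain ⟨q, hq, hπ, hqw⟩ := hμ.exists_refinement hv hr (fun x => (ρ x, ρ (τ x))) w hw0 hwH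
    (fun z => by
      change _ = M z.1 z.2
      rw [← hw, Finset.sum_filter]
      simp [Prod.ext_iff])
  refine ⟨⟨κ, inferInstance, q, τ, hq, fun j => by rw [hqw, hqw, hwτ]⟩, ρ, ?_, ?_⟩
  · funext x
    exact (congrArg Prod.fst (congrFun hπ x)).symm
  · funext x
    exact (congrArg Prod.snd (congrFun hπ x)).symm

/-- Realize `P` by a homeomorphism and approximate that on the common refinement of `P.p` and `r`.
-/
theorem exists_refining (hμ : IsGood μ) (hv : clopenValues μ = (H : Set ℝ) ∩ Icc 0 1)
    (P : PeriodicPartition μ) {ι : Type} [Finite ι] {r : Cantor → ι} (hr : IsLocallyConstant r) :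
    ∃ Q, P ≤ Q ∧ ∃ ρ : Q.κ → ι, r = ρ ∘ Q.p := by
  have := P.finite
  have : Finite P.toPair.κ := P.finite
  obtain ⟨g, hg, hgp⟩ := hμ.exists_homeo_comp_eq hv P.toPair.isLocallyConstant
    P.toPair.isLocallyConstant' P.toPair.real_eq
  obtain ⟨Q, ρ, h1, h2⟩ := exists_approx hμ hv hg (P.isLocallyConstant.prodMk hr)
  refine ⟨Q, le_iff.2 ⟨Prod.fst ∘ ρ, ?_, ?_⟩, Prod.snd ∘ ρ, ?_⟩
  · exact hgp.symm.trans (congrArg (Prod.fst ∘ ·) h2)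
  · exact congrArg (Prod.fst ∘ ·) h1
  · exact congrArg (Prod.snd ∘ ·) h1

/-- Some labels may have empty fibres, and the semiconjugacy is assumed only on the others. Since
`σ` preserves measures and `μ` is full, a label is nonempty when its image is, so the relation can
be iterated backwards from a nonempty label. -/
theorem mem_range_iterate {ι : Type*} [Finite ι] {p : Cantor → ι} (hμ : IsGood μ)
    (hp : IsLocallyConstant p) {σ : Equiv.Perm ι}
    (hσ : ∀ j, μ.real (p ⁻¹' {σ j}) = μ.real (p ⁻¹' {j})) {α : Type*} {ρ : ι → α}
    {σ₀ : Equiv.Perm α} (h : ∀ x, ρ (σ (p x)) = σ₀ (ρ (p x))) (k : ℕ) :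
    ∀ x, (σ ^ k) x ∈ range p → x ∈ range p ∧ ρ ((σ ^ k) x) = (σ₀ ^ k) (ρ x) := by
  induction k with
  | zero => exact fun x hx => ⟨hx, rfl⟩
  | succ k ih =>
    intro x hx
    rw [pow_succ, Equiv.Perm.mul_apply] at hx
    obtain ⟨⟨z, hz⟩, h2⟩ := ih _ hx
    have hpos := hμ.real_pos (hp {σ x}) ⟨z, hz⟩
    rw [hσ] at hpos
    obtain ⟨y, rfl⟩ := nonempty_of_measureReal_ne_zero hpos.ne'
    refine ⟨⟨y, rfl⟩, ?_⟩
    rw [pow_succ, Equiv.Perm.mul_apply, h2, h, pow_succ, Equiv.Perm.mul_apply]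

/-- Division by the order of `ω` is the point where divisibility of `H` enters. Averaging over a
full period makes the result invariant. -/
theorem exists_average (H : AddSubgroup ℝ) (hdiv : ∀ h ∈ H, ∀ n : ℕ, n ≠ 0 → h / n ∈ H)
    {α : Type*} [Finite α] (ω : Equiv.Perm α) (c : α → ℝ) (hc0 : ∀ z, 0 ≤ c z)
    (hcH : ∀ z, c z ∈ H) :
    ∃ (N : ℕ) (d : α → ℝ), N ≠ 0 ∧ (∀ z, d z = (∑ k ∈ Finset.range N, c ((ω ^ k) z)) / N) ∧
      (∀ z, 0 ≤ d z) ∧ (∀ z, d z ∈ H) ∧ ∀ z, d (ω z) = d z := by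
  have hN : orderOf ω ≠ 0 := (orderOf_pos ω).ne'
  refine ⟨orderOf ω, fun z => (∑ k ∈ Finset.range (orderOf ω), c ((ω ^ k) z)) / orderOf ω, hN,
    fun _ => rfl, fun z => div_nonneg (Finset.sum_nonneg fun _ _ => hc0 _) (Nat.cast_nonneg _),
    fun z => hdiv _ (H.sum_mem fun _ _ => hcH _) _ hN, fun z => ?_⟩
  refine congrArg (· / (orderOf ω : ℝ)) ?_
  have h1 := Finset.sum_range_succ (fun k => c ((ω ^ k) z)) (orderOf ω)
  have h2 := Finset.sum_range_succ' (fun k => c ((ω ^ k) z)) (orderOf ω)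
  have h3 : ∀ k : ℕ, (ω ^ k) (ω z) = (ω ^ (k + 1)) z := fun k => by
    rw [pow_succ, Equiv.Perm.mul_apply]
  rw [pow_orderOf_eq_one] at h1
  rw [pow_zero] at h2
  rw [Finset.sum_congr rfl fun k _ => congrArg c (h3 k)]
  linarith

/-- Amalgamation of two periodic partitions over a common quotient. -/
theorem exists_amalgam (hμ : IsGood μ) (hv : clopenValues μ = (H : Set ℝ) ∩ Icc 0 1)
    (hdiv : ∀ h ∈ H, ∀ n : ℕ, n ≠ 0 → h / n ∈ H) (P Q : PeriodicPartition μ)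
    {ι : Type} (ρ : P.κ → ι) (π : Q.κ → ι) (σ₀ : Equiv.Perm ι) (hρπ : ρ ∘ P.p = π ∘ Q.p)
    (hρ : ∀ x, ρ (P.σ (P.p x)) = σ₀ (ρ (P.p x))) (hπ : ∀ x, π (Q.σ (Q.p x)) = σ₀ (π (Q.p x))) :
    ∃ R, P ≤ R ∧ ∃ θ : R.κ → Q.κ, θ ∘ R.σ ∘ R.p = Q.σ ∘ θ ∘ R.p ∧
      π ∘ θ ∘ R.p = π ∘ Q.p ∧
      ∀ j, μ.real ((θ ∘ R.p) ⁻¹' {j}) = μ.real (Q.p ⁻¹' {j}) := by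
  classical
  have := hμ.isProbabilityMeasure
  have := P.finite
  have := Q.finite
  cases nonempty_fintype P.κ
  cases nonempty_fintype Q.κ
  let r : Cantor → P.κ × Q.κ := fun x => (P.p x, Q.p x)
  have hr : IsLocallyConstant r := P.isLocallyConstant.prodMk Q.isLocallyConstant
  let ω : Equiv.Perm (P.κ × Q.κ) := Equiv.prodCongr P.σ Q.σ
  have hω : ∀ (k : ℕ) z, (ω ^ k) z = ((P.σ ^ k) z.1, (Q.σ ^ k) z.2) := by
    intro k
    induction k with
    | zero => exact fun z => rfl
    | succ k ih => exact fun z => by simp [pow_succ, ih, ω]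
  have hPk : ∀ (k : ℕ) j, μ.real (P.p ⁻¹' {(P.σ ^ k) j}) = μ.real (P.p ⁻¹' {j}) := by
    intro k
    induction k with
    | zero => exact fun z => rfl
    | succ k ih => exact fun z => by rw [pow_succ, Equiv.Perm.mul_apply, ih, P.real_eq]
  have hQk : ∀ (k : ℕ) j, μ.real (Q.p ⁻¹' {(Q.σ ^ k) j}) = μ.real (Q.p ⁻¹' {j}) := by
    intro k
    induction k with
    | zero => exact fun z => rfl
    | succ k ih => exact fun z => by rw [pow_succ, Equiv.Perm.mul_apply, ih, Q.real_eq]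
  -- The joint distribution of the two partitions is made invariant under the product permutation.
  -- Its marginals were already invariant, so they do not change.
  obtain ⟨N, d, hN, hd, hd0, hdH, hdω⟩ := exists_average H hdiv ω (fun z => μ.real (r ⁻¹' {z}))
    (fun _ => measureReal_nonneg) (fun z => real_mem hv (hr.isClopen_fiber _))
  have hN' : (N : ℝ) ≠ 0 := Nat.cast_ne_zero.2 hN
  have hfst : ∀ i, ∑ j, μ.real (r ⁻¹' {(i, j)}) = μ.real (P.p ⁻¹' {i}) :=
    fun i => sum_real_fiber_fst hr i
  have hsnd : ∀ j, ∑ i, μ.real (r ⁻¹' {(i, j)}) = μ.real (Q.p ⁻¹' {j}) :=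
    fun j => sum_real_fiber_snd hr j
  have hd1 : ∀ i, ∑ j, d (i, j) = μ.real (P.p ⁻¹' {i}) := by
    intro i
    simp only [hd, hω]
    rw [← Finset.sum_div, Finset.sum_comm, div_eq_iff hN']
    rw [Finset.sum_congr rfl fun k _ =>
      (Equiv.sum_comp (Q.σ ^ k) fun j => μ.real (r ⁻¹' {((P.σ ^ k) i, j)}))]
    simp [hfst, hPk, mul_comm]
  have hd2 : ∀ j, ∑ i, d (i, j) = μ.real (Q.p ⁻¹' {j}) := by
    intro j
    simp only [hd, hω]
    rw [← Finset.sum_div, Finset.sum_comm, div_eq_iff hN']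
    rw [Finset.sum_congr rfl fun k _ =>
      (Equiv.sum_comp (P.σ ^ k) fun i => μ.real (r ⁻¹' {(i, (Q.σ ^ k) j)}))]
    simp [hsnd, hQk, mul_comm]
  -- The averaged weights still live over the diagonal of `ι`: some iterate of `z` labels an actual
  -- point, where both quotients agree, and `σ₀ ^ k` is injective.
  have hsupp : ∀ z, d z ≠ 0 → ρ z.1 = π z.2 := by
    intro z hz
    rw [hd] at hz
    obtain ⟨k, -, hk⟩ := Finset.exists_ne_zero_of_sum_ne_zero (left_ne_zero_of_mul hz)
    obtain ⟨y, hy⟩ := nonempty_of_measureReal_ne_zero hk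
    have hy' : r y = (ω ^ k) z := hy
    rw [hω] at hy'
    have e1 : P.p y = (P.σ ^ k) z.1 := congrArg Prod.fst hy'
    have e2 : Q.p y = (Q.σ ^ k) z.2 := congrArg Prod.snd hy'
    have h1 := (mem_range_iterate hμ P.isLocallyConstant P.real_eq hρ k z.1 ⟨y, e1⟩).2
    have h2 := (mem_range_iterate hμ Q.isLocallyConstant Q.real_eq hπ k z.2 ⟨y, e2⟩).2
    refine (σ₀ ^ k).injective ?_
    rw [← h1, ← h2, ← e1, ← e2]
    exact congrFun hρπ y
  -- The partition of `P` is refined by the weights `d`. The second coordinate is not `Q.p` but a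
  -- copy of it with the same measures and the same quotient.
  obtain ⟨s, hs, hsP, hsd⟩ := hμ.exists_refinement hv P.isLocallyConstant
    (Prod.fst : P.κ × Q.κ → P.κ) d hd0 hdH (fun i => (sum_filter_fst d i).trans (hd1 i))
  refine ⟨⟨P.κ × Q.κ, inferInstance, s, ω, hs, fun j => by rw [hsd, hsd, hdω]⟩,
    le_iff.2 ⟨Prod.fst, ?_, hsP.symm⟩, Prod.snd, rfl, ?_, ?_⟩
  · rw [← hsP]; rfl
  · rw [← hρπ, ← hsP]
    funext x
    refine (hsupp (s x) ?_).symm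
    rw [← hsd]
    exact (hμ.real_pos (hs {s x}) ⟨x, rfl⟩).ne'
  · intro j
    rw [← sum_real_fiber_snd hs, ← hd2]
    exact Finset.sum_congr rfl fun i _ => hsd _

end PeriodicPartition

end PeriodicPartition

/-! ### The compact-open topology in terms of partitions. -/

section CompactOpen

theorem isOpen_setOf_comp_eq {κ : Type*} [Finite κ] {q r : Cantor → κ} (hq : IsLocallyConstant q)
    (hr : IsLocallyConstant r) : IsOpen {f : C(Cantor, Cantor) | q ∘ f = r} := by
  have : {f : C(Cantor, Cantor) | q ∘ f = r} =
      ⋂ j, {f : C(Cantor, Cantor) | MapsTo f (r ⁻¹' {j}) (q ⁻¹' {j})} := by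
    ext f
    simp only [mem_ofPred_eq, mem_iInter]
    constructor
    · rintro h j x hx
      rw [← h] at hx
      exact hx
    · exact fun h => funext fun x => h (r x) rfl
  rw [this]
  exact isOpen_iInter_of_finite fun j =>
    ContinuousMap.isOpen_setOfPred_mapsTo (hr.isClosed_fiber j).isCompact (hq _)

/-- For a subbasic set, a clopen `W` between the compact image `f '' K` and `U` gives the two-piece
partition; intersections use joint partitions. -/
theorem exists_isLocallyConstant_comp_eq_subset {O : Set C(Cantor, Cantor)} (hO : IsOpen O) :
    ∀ f ∈ O, ∃ (ι : Type) (_ : Finite ι) (p : Cantor → ι), IsLocallyConstant p ∧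
      {f' : C(Cantor, Cantor) | p ∘ f' = p ∘ f} ⊆ O := by
  induction hO with
  | basic s hs =>
    rintro f hf
    obtain ⟨K, hK, U, hU, rfl⟩ := hs
    obtain ⟨W, hW, hKW, hWU⟩ := exists_clopen_of_closed_subset_open
      (hK.image f.continuous).isClosed hU (image_subset_iff.2 hf)
    refine ⟨Prop, inferInstance, fun x => x ∈ W, isLocallyConstant_mem hW, fun f' hf' x hx => ?_⟩
    exact hWU ((congrFun hf' x).mpr (hKW ⟨x, hx, rfl⟩))
  | univ => exact fun f _ => ⟨Unit, inferInstance, fun _ => (), IsLocallyConstant.const _,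
      subset_univ _⟩
  | inter s t _ _ hs ht =>
    rintro f ⟨hfs, hft⟩
    obtain ⟨ι, _, p, hp, hps⟩ := hs f hfs
    obtain ⟨κ, _, q, hq, hqt⟩ := ht f hft
    refine ⟨ι × κ, inferInstance, fun x => (p x, q x), hp.prodMk hq, fun f' hf' => ⟨hps ?_, hqt ?_⟩⟩
    · exact congrArg (Prod.fst ∘ ·) hf'
    · exact congrArg (Prod.snd ∘ ·) hf'
  | sUnion S _ ih =>
    rintro f ⟨s, hs, hfs⟩
    obtain ⟨ι, hι, p, hp, hps⟩ := ih s hs f hfs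
    exact ⟨ι, hι, p, hp, hps.trans (subset_sUnion_of_mem hs)⟩

variable {μ : Measure Cantor}

/-- The inclusion of `Homeo μ` in the space of continuous maps. -/
def Homeo.toContinuousMap (h : Homeo μ) : C(Cantor, Cantor) := ⟨h.1, h.1.continuous⟩

theorem Homeo.isInducing_toContinuousMap :
    Topology.IsInducing (Homeo.toContinuousMap : Homeo μ → C(Cantor, Cantor)) :=
  Topology.IsInducing.comp (g := fun h : Cantor ≃ₜ Cantor => (⟨h, h.continuous⟩ : C(Cantor, Cantor)))
    ⟨rfl⟩ Topology.IsInducing.subtypeVal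

theorem Homeo.isOpen_setOf_comp_eq {κ : Type*} [Finite κ] {q r : Cantor → κ}
    (hq : IsLocallyConstant q) (hr : IsLocallyConstant r) :
    IsOpen {h : Homeo μ | q ∘ h.1 = r} :=
  (GoodMeasures.isOpen_setOf_comp_eq hq hr).preimage Homeo.isInducing_toContinuousMap.continuous

theorem Homeo.exists_comp_eq_subset {O : Set (Homeo μ)} (hO : IsOpen O) {g : Homeo μ}
    (hg : g ∈ O) : ∃ (ι : Type) (_ : Finite ι) (p : Cantor → ι), IsLocallyConstant p ∧
      {h : Homeo μ | p ∘ h.1 = p ∘ g.1} ⊆ O := by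
  obtain ⟨O', hO', rfl⟩ := Homeo.isInducing_toContinuousMap.isOpen_iff.1 hO
  obtain ⟨ι, hι, p, hp, hsub⟩ := exists_isLocallyConstant_comp_eq_subset hO' _ hg
  exact ⟨ι, hι, p, hp, fun h hh => hsub hh⟩

end CompactOpen

/-! ### Generic homeomorphisms and the strong Rokhlin property. -/

section Generic

variable {μ : Measure Cantor} {H : AddSubgroup ℝ}

instance countable_locallyConstant (k : ℕ) : Countable (LocallyConstant Cantor (Fin k)) := by
  refine Function.Injective.countable (f := fun (q : LocallyConstant Cantor (Fin k)) (j : Fin k) =>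
    (⟨q ⁻¹' {j}, q.isLocallyConstant.isClopen_preimage _⟩ : {A : Set Cantor // IsClopen A})) ?_
  intro q r h
  ext1 x
  have hqr : q ⁻¹' {q x} = r ⁻¹' {q x} := congrArg Subtype.val (congrFun h (q x))
  have hx : x ∈ r ⁻¹' {q x} := by rw [← hqr]; rfl
  exact hx.symm

/-- The finite combinatorial data of an extension of periodic partitions. -/
structure ExtensionData (μ : Measure Cantor) (k l : ℕ) where
  q : LocallyConstant Cantor (Fin k)
  τ : Equiv.Perm (Fin k)
  π : Fin k → Fin l
  σ : Equiv.Perm (Fin l)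
  real_eq : ∀ j, μ.real (q ⁻¹' {τ j}) = μ.real (q ⁻¹' {j})
  semiconj : ∀ x, π (τ (q x)) = σ (π (q x))

instance (k l : ℕ) : Countable (ExtensionData μ k l) :=
  Function.Injective.countable (f := fun d : ExtensionData μ k l => (d.q, d.τ, d.π, d.σ)) <| by
    rintro ⟨q, τ, π, σ, _, _⟩ ⟨q', τ', π', σ', _, _⟩ h
    simp only [Prod.mk.injEq] at h
    obtain ⟨rfl, rfl, rfl, rfl⟩ := h
    rfl

/-- A homeomorphism is generic if it has arbitrarily fine finite invariant clopen partitions and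
realizes all measure-theoretically possible extensions of these. -/
structure IsGeneric (μ : Measure Cantor) (g : Cantor ≃ₜ Cantor) : Prop where
  exists_periodic : ∀ (l : ℕ) (r : LocallyConstant Cantor (Fin l)),
    ∃ (k : ℕ) (q : LocallyConstant Cantor (Fin k)) (τ : Equiv.Perm (Fin k)) (ρ : Fin k → Fin l),
      q ∘ g = τ ∘ q ∧ r = ρ ∘ q
  exists_extension : ∀ (k l : ℕ) (d : ExtensionData μ k l), (d.π ∘ d.q) ∘ g = d.σ ∘ d.π ∘ d.q →
    ∃ q' : LocallyConstant Cantor (Fin k), q' ∘ g = d.τ ∘ q' ∧ d.π ∘ q' = d.π ∘ d.q ∧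
      ∀ j, μ.real (q' ⁻¹' {j}) = μ.real (d.q ⁻¹' {j})

/-- There are countably many requirements, as there are countably many clopen sets. Each is an open
condition: the premise of an extension requirement is clopen, so the implication is open. -/
theorem isGδ_isGeneric : IsGδ {g : Homeo μ | IsGeneric μ g.1} := by
  have : {g : Homeo μ | IsGeneric μ g.1} =
      (⋂ (l : ℕ) (r : LocallyConstant Cantor (Fin l)), ⋃ (k : ℕ)
        (q : LocallyConstant Cantor (Fin k)) (τ : Equiv.Perm (Fin k)) (ρ : Fin k → Fin l)
        (_ : (r : Cantor → Fin l) = ρ ∘ q), {g : Homeo μ | q ∘ g.1 = τ ∘ q}) ∩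
      ⋂ (k : ℕ) (l : ℕ) (d : ExtensionData μ k l),
        ({g : Homeo μ | (d.π ∘ d.q) ∘ g.1 = d.σ ∘ d.π ∘ d.q}ᶜ ∪
          ⋃ (q' : LocallyConstant Cantor (Fin k)) (_ : d.π ∘ q' = d.π ∘ d.q ∧
            ∀ j, μ.real (q' ⁻¹' {j}) = μ.real (d.q ⁻¹' {j})),
            {g : Homeo μ | q' ∘ g.1 = d.τ ∘ q'}) := by
    ext g
    simp only [mem_ofPred_eq, mem_inter_iff, mem_iInter, mem_iUnion, mem_union, mem_compl_iff,
      exists_prop]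
    constructor
    · rintro ⟨h1, h2⟩
      refine ⟨fun l r => ?_, fun k l d => ?_⟩
      · obtain ⟨k, q, τ, ρ, h, h'⟩ := h1 l r
        exact ⟨k, q, τ, ρ, h', h⟩
      · by_cases hd : (d.π ∘ d.q) ∘ g.1 = d.σ ∘ d.π ∘ d.q
        · obtain ⟨q', h, h'⟩ := h2 k l d hd
          exact .inr ⟨q', h', h⟩
        · exact .inl hd
    · rintro ⟨h1, h2⟩
      refine ⟨fun l r => ?_, fun k l d hd => ?_⟩
      · obtain ⟨k, q, τ, ρ, h, h'⟩ := h1 l r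
        exact ⟨k, q, τ, ρ, h', h⟩
      · obtain ⟨q', h, h'⟩ := (h2 k l d).resolve_left fun h => h hd
        exact ⟨q', h', h⟩
  rw [this]
  refine IsGδ.inter (IsGδ.iInter fun l => IsGδ.iInter fun r => IsOpen.isGδ ?_)
    (IsGδ.iInter fun k => IsGδ.iInter fun l => IsGδ.iInter fun d => IsOpen.isGδ ?_)
  · exact isOpen_iUnion fun k => isOpen_iUnion fun q => isOpen_iUnion fun τ => isOpen_iUnion fun ρ =>
      isOpen_iUnion fun _ => Homeo.isOpen_setOf_comp_eq q.isLocallyConstant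
        (q.isLocallyConstant.comp τ)
  · refine IsOpen.union ?_ (isOpen_iUnion fun q => isOpen_iUnion fun _ =>
      Homeo.isOpen_setOf_comp_eq q.isLocallyConstant (q.isLocallyConstant.comp d.τ))
    have hd : IsLocallyConstant (d.π ∘ d.q) := d.q.isLocallyConstant.comp d.π
    refine isOpen_iff_forall_mem_open.2 fun g hg => ⟨{h | (d.π ∘ d.q) ∘ h.1 = (d.π ∘ d.q) ∘ g.1},
      fun h hh hh' => hg ?_, Homeo.isOpen_setOf_comp_eq hd (hd.comp_continuous g.1.continuous), rfl⟩
    exact Eq.trans (Eq.symm hh) hh'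

namespace IsGeneric

theorem exists_periodicPartition {g : Cantor ≃ₜ Cantor} (hg : IsGeneric μ g) (hgμ : g ∈ Homeo μ)
    {ι : Type} [Finite ι] {r : Cantor → ι} (hr : IsLocallyConstant r) :
    ∃ Q : PeriodicPartition μ, Q.p ∘ g = Q.σ ∘ Q.p ∧ ∃ ρ : Q.κ → ι, r = ρ ∘ Q.p := by
  let e := Finite.equivFin ι
  obtain ⟨k, q, τ, ρ, hq, hρ⟩ := hg.exists_periodic _ ⟨e ∘ r, hr.comp e⟩
  refine ⟨⟨Fin k, inferInstance, q, τ, q.isLocallyConstant, fun j => ?_⟩, hq, e.symm ∘ ρ, ?_⟩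
  · rw [← Homeo.real_preimage hgμ 
      (IsLocallyConstant.measurableSet_preimage (q := q) q.isLocallyConstant _), ← preimage_comp, hq]
    congr 1
    ext x
    simp
  · have : e ∘ r = ρ ∘ q := hρ
    rw [Function.comp_assoc, ← this]
    funext x
    simp

theorem exists_realization {g : Cantor ≃ₜ Cantor} (hg : IsGeneric μ g) (Q : PeriodicPartition μ)
    {ι : Type} [Finite ι] (π : Q.κ → ι) (σ : Equiv.Perm ι)
    (hπ : ∀ x, π (Q.σ (Q.p x)) = σ (π (Q.p x))) (h : (π ∘ Q.p) ∘ g = σ ∘ π ∘ Q.p) :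
    ∃ q : Cantor → Q.κ, IsLocallyConstant q ∧ q ∘ g = Q.σ ∘ q ∧ π ∘ q = π ∘ Q.p ∧
      ∀ j, μ.real (q ⁻¹' {j}) = μ.real (Q.p ⁻¹' {j}) := by
  have := Q.finite
  let e := Finite.equivFin Q.κ
  let e' := Finite.equivFin ι
  have hpre : ∀ (q : Cantor → Q.κ) j, (e ∘ q) ⁻¹' {j} = q ⁻¹' {e.symm j} := fun q j => by
    ext x; simp [Equiv.eq_symm_apply]
  obtain ⟨q, hq1, hq2, hq3⟩ := hg.exists_extension _ _
    ⟨⟨e ∘ Q.p, Q.isLocallyConstant.comp e⟩, e.permCongr Q.σ, e' ∘ π ∘ e.symm, e'.permCongr σ,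
      fun j => by
        change μ.real ((e ∘ Q.p) ⁻¹' _) = μ.real ((e ∘ Q.p) ⁻¹' _)
        rw [hpre, hpre]
        simpa [Equiv.permCongr_apply] using Q.real_eq _,
      fun x => by simp [Equiv.permCongr_apply, hπ]⟩
    (by
      funext x
      have := congrFun h x
      simp only [Function.comp_apply] at this
      simp [Equiv.permCongr_apply, this])
  refine ⟨e.symm ∘ q, q.isLocallyConstant.comp _, ?_, ?_, fun j => ?_⟩
  · funext x
    have := congrFun hq1 x
    simp only [Function.comp_apply] at this
    simp [this, Equiv.permCongr_apply]
  · funext x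
    have := congrFun hq2 x
    simpa using this
  · have h1 := hq3 (e j)
    change _ = μ.real ((e ∘ Q.p) ⁻¹' _) at h1
    rw [hpre, Equiv.symm_apply_apply] at h1
    rw [← h1]
    congr 1
    ext x
    simp [Equiv.symm_apply_eq]

/-- A `g`-invariant partition fine enough for `P.p` and `A` is carried over by a measure-preserving
`f` taking `P.p'` to `P.p`. The copy extends the action of `g'` on `P.p'`, so genericity of `g'`
realizes it. -/
theorem exists_forth (hμ : IsGood μ) (hv : clopenValues μ = (H : Set ℝ) ∩ Icc 0 1)
    {g g' : Cantor ≃ₜ Cantor} (hg : IsGeneric μ g) (hgμ : g ∈ Homeo μ) (hg' : IsGeneric μ g')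
    (P : PartitionPair μ) {σ : Equiv.Perm P.κ} (hp : P.p ∘ g = σ ∘ P.p)
    (hp' : P.p' ∘ g' = σ ∘ P.p') {A : Set Cantor} (hA : IsClopen A) :
    ∃ Q, P ≤ Q ∧ (∃ τ : Equiv.Perm Q.κ, Q.p ∘ g = τ ∘ Q.p ∧ Q.p' ∘ g' = τ ∘ Q.p') ∧
      ∃ T, A = Q.p ⁻¹' T := by
  have := P.finite
  obtain ⟨Q, hQg, ρ, hρ⟩ := hg.exists_periodicPartition hgμ
    (P.isLocallyConstant.prodMk (isLocallyConstant_mem hA))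
  have hρ1 : ∀ x, (ρ (Q.p x)).1 = P.p x := fun x => (congrArg Prod.fst (congrFun hρ x)).symm
  have hρ2 : ∀ x, (ρ (Q.p x)).2 = (x ∈ A) := fun x => (congrArg Prod.snd (congrFun hρ x)).symm
  obtain ⟨f, hf, hfp⟩ := hμ.exists_homeo_comp_eq hv P.isLocallyConstant' P.isLocallyConstant
    fun j => (P.real_eq j).symm
  have hfp' : ∀ x, P.p (f x) = P.p' x := congrFun hfp
  have hlc : IsLocallyConstant (Q.p ∘ f) := Q.isLocallyConstant.comp_continuous f.continuous
  have hreal : ∀ j, μ.real ((Q.p ∘ f) ⁻¹' {j}) = μ.real (Q.p ⁻¹' {j}) := fun j =>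
    Homeo.real_preimage hf (Q.isLocallyConstant.measurableSet_preimage _)
  have hQg' : ∀ x, Q.σ (Q.p x) = Q.p (g x) := fun x => (congrFun hQg x).symm
  obtain ⟨q, hq, hqg, hqπ, hqr⟩ := hg'.exists_realization
    ⟨Q.κ, Q.finite, Q.p ∘ f, Q.σ, hlc, fun j => by rw [hreal, hreal, Q.real_eq]⟩
    (Prod.fst ∘ ρ) σ
    (fun x => by
      simp only [Function.comp_apply, hQg', hρ1]
      exact congrFun hp (f x))
    (by
      funext x
      simp only [Function.comp_apply, hρ1, hfp']
      exact congrFun hp' x)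
  refine ⟨⟨Q.κ, Q.finite, Q.p, q, Q.isLocallyConstant, hq, fun j => by rw [hqr, hreal]⟩,
    ⟨Prod.fst ∘ ρ, funext fun x => (hρ1 x).symm, ?_⟩, ⟨Q.σ, hQg, hqg⟩, {j | (ρ j).2}, ?_⟩
  · rw [hqπ]
    funext x
    exact ((hρ1 (f x)).trans (hfp' x)).symm
  · ext x
    exact (hρ2 x).symm.to_iff

/-- The admissible stages are those on which `g` and `g'` induce the same permutation; in the limit
`f` intertwines them. -/
theorem exists_conj (hμ : IsGood μ) (hv : clopenValues μ = (H : Set ℝ) ∩ Icc 0 1)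
    {g g' : Cantor ≃ₜ Cantor} (hg : IsGeneric μ g) (hgμ : g ∈ Homeo μ) (hg' : IsGeneric μ g')
    (hgμ' : g' ∈ Homeo μ) : ∃ f ∈ Homeo μ, f * g = g' * f := by
  obtain ⟨f, hf, -, hfs⟩ := PartitionPair.backAndForth hμ
    (fun P => ∃ σ : Equiv.Perm P.κ, P.p ∘ g = σ ∘ P.p ∧ P.p' ∘ g' = σ ∘ P.p')
    (fun P ⟨σ, h, h'⟩ A hA => exists_forth hμ hv hg hgμ hg' P h h' hA)
    (fun P ⟨σ, h, h'⟩ A hA => by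
      obtain ⟨Q, hPQ, ⟨τ, h1, h2⟩, hT⟩ := exists_forth hμ hv hg' hgμ' hg P.swap h' h hA
      exact ⟨Q.swap, PartitionPair.swap_le_swap hPQ, ⟨τ, h2, h1⟩, hT⟩)
    (P := ⟨Unit, inferInstance, fun _ => (), fun _ => (), IsLocallyConstant.const _,
      IsLocallyConstant.const _, fun _ => rfl⟩) ⟨1, rfl, rfl⟩
  refine ⟨f, hf, Homeomorph.ext fun x => eq_of_forall_isClopen fun A hA => ?_⟩
  obtain ⟨Q, ⟨σ, h1, h2⟩, hQf, T, rfl⟩ := hfs A hA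
  have h1 : ∀ x, Q.p (g x) = σ (Q.p x) := congrFun h1
  have h2 : ∀ x, Q.p' (g' x) = σ (Q.p' x) := congrFun h2
  have hQf : ∀ x, Q.p' (f x) = Q.p x := congrFun hQf
  change Q.p' (f (g x)) ∈ T ↔ Q.p' (g' (f x)) ∈ T
  rw [hQf, h1, h2, hQf]

theorem conj {g f : Cantor ≃ₜ Cantor} (hg : IsGeneric μ g) (hf : f ∈ Homeo μ) :
    IsGeneric μ (f * g * f⁻¹) := by
  have hfi : f⁻¹ ∈ Homeo μ := (Homeo μ).inv_mem hf
  have key : ∀ {k : ℕ} (q : LocallyConstant Cantor (Fin k)) j,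
      μ.real ((q ∘ f) ⁻¹' {j}) = μ.real (q ⁻¹' {j}) := fun q j =>
    Homeo.real_preimage hf (q.isLocallyConstant.measurableSet_preimage _)
  have key' : ∀ {k : ℕ} (q : LocallyConstant Cantor (Fin k)) j,
      μ.real ((q ∘ f.symm) ⁻¹' {j}) = μ.real (q ⁻¹' {j}) := fun q j =>
    Homeo.real_preimage hfi (q.isLocallyConstant.measurableSet_preimage _)
  constructor
  · intro l r
    obtain ⟨k, q, τ, ρ, h1, h2⟩ := hg.exists_periodic l
      ⟨r ∘ f, r.isLocallyConstant.comp_continuous f.continuous⟩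
    refine ⟨k, ⟨q ∘ f.symm, q.isLocallyConstant.comp_continuous f.symm.continuous⟩, τ, ρ, ?_, ?_⟩
    · funext x
      change q (f.symm (f (g (f.symm x)))) = τ (q (f.symm x))
      rw [Homeomorph.symm_apply_apply]
      exact congrFun h1 _
    · funext x
      have := congrFun h2 (f.symm x)
      simpa using this
  · intro k l d hd
    obtain ⟨q, h1, h2, h3⟩ := hg.exists_extension k l
      ⟨⟨d.q ∘ f, d.q.isLocallyConstant.comp_continuous f.continuous⟩, d.τ, d.π, d.σ,
        fun j => (key _ _).trans ((d.real_eq j).trans (key _ _).symm),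
        fun x => d.semiconj (f x)⟩
      (by
        funext x
        have := congrFun hd (f x)
        change d.π (d.q (f (g (f.symm (f x))))) = _ at this
        rw [Homeomorph.symm_apply_apply] at this
        exact this)
    refine ⟨⟨q ∘ f.symm, q.isLocallyConstant.comp_continuous f.symm.continuous⟩, ?_, ?_, ?_⟩
    · funext x
      change q (f.symm (f (g (f.symm x)))) = d.τ (q (f.symm x))
      rw [Homeomorph.symm_apply_apply]
      exact congrFun h1 _
    · funext x
      have := congrFun h2 (f.symm x)
      simpa using this
    · exact fun j => (key' q j).trans ((h3 j).trans (key d.q j))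

/-- Generic homeomorphisms realize every periodic partition. -/
theorem exists_isGeneric (hμ : IsGood μ) (hv : clopenValues μ = (H : Set ℝ) ∩ Icc 0 1)
    (hdiv : ∀ h ∈ H, ∀ n : ℕ, n ≠ 0 → h / n ∈ H) (P : PeriodicPartition μ) :
    ∃ g ∈ Homeo μ, IsGeneric μ g ∧ P.p ∘ g = P.σ ∘ P.p := by
  classical
  -- An extension requirement first makes `d.π ∘ d.q` a quotient of the stage, which decides whether
  -- the permutation induces `d.σ` on it. If so, amalgamation supplies a realization; if not, no
  -- homeomorphism realizing the stage meets the premise.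
  let D : (Σ l : ℕ, LocallyConstant Cantor (Fin l)) ⊕
      (Σ kl : ℕ × ℕ, ExtensionData μ kl.1 kl.2) → PeriodicPartition μ → Prop := fun i Q =>
    Sum.elim (fun r => ∃ ρ : Q.κ → Fin r.1, r.2 = ρ ∘ Q.p)
      (fun d => (∃ ρ : Q.κ → Fin d.1.2, d.2.π ∘ d.2.q = ρ ∘ Q.p) ∧
        ∀ ρ : Q.κ → Fin d.1.2, d.2.π ∘ d.2.q = ρ ∘ Q.p →
          (∀ x, ρ (Q.σ (Q.p x)) = d.2.σ (ρ (Q.p x))) →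
          ∃ θ : Q.κ → Fin d.1.1, θ ∘ Q.σ ∘ Q.p = d.2.τ ∘ θ ∘ Q.p ∧
            d.2.π ∘ θ ∘ Q.p = d.2.π ∘ d.2.q ∧
            ∀ j, μ.real ((θ ∘ Q.p) ⁻¹' {j}) = μ.real (d.2.q ⁻¹' {j})) i
  obtain ⟨s, hs, h0, -, hD⟩ := exists_monotone_seq (fun _ : PeriodicPartition μ => True) D (by
    rintro (r | ⟨⟨k, l⟩, d⟩) P -
    · obtain ⟨Q, hPQ, hQ⟩ := P.exists_refining hμ hv r.2.isLocallyConstant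
      exact ⟨Q, hPQ, trivial, hQ⟩
    · obtain ⟨Q, hPQ, ρ, hρ⟩ := P.exists_refining hμ hv (d.q.isLocallyConstant.comp d.π)
      by_cases hex : ∃ ρ : Q.κ → Fin l, d.π ∘ d.q = ρ ∘ Q.p ∧
          ∀ x, ρ (Q.σ (Q.p x)) = d.σ (ρ (Q.p x))
      · obtain ⟨ρ', h1, h2⟩ := hex
        obtain ⟨R, hQR, θ, hθ⟩ := Q.exists_amalgam hμ hv hdiv
          ⟨Fin k, inferInstance, d.q, d.τ, d.q.isLocallyConstant, d.real_eq⟩ ρ' d.π d.σ h1.symm h2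
          d.semiconj
        have hρ : d.π ∘ d.q = ρ ∘ Q.p := hρ
        refine ⟨R, hPQ.trans hQR, trivial, ?_, fun _ _ _ => ⟨θ, hθ⟩⟩
        obtain ⟨ω, -, hω⟩ := PeriodicPartition.le_iff.1 hQR
        exact ⟨ρ ∘ ω, by rw [hρ, hω]; rfl⟩
      · exact ⟨Q, hPQ, trivial, ⟨ρ, hρ⟩, fun ρ' h1 h2 => absurd ⟨ρ', h1, h2⟩ hex⟩) (p := P) trivial
  have hsat : ∀ A : Set Cantor, IsClopen A → ∃ n T, A = (s n).p ⁻¹' T := by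
    intro A hA
    obtain ⟨n, ρ, hρ⟩ := hD (.inl ⟨2, fun x => if x ∈ A then 1 else 0,
      (isLocallyConstant_mem hA).comp fun b : Prop => if b then (1 : Fin 2) else 0⟩)
    refine ⟨n, ρ ⁻¹' {1}, ?_⟩
    rw [← preimage_comp, ← hρ]
    ext x
    by_cases hx : x ∈ A <;> simp [hx]
  obtain ⟨g, hg, hgs⟩ := PartitionPair.exists_homeo hμ (s := fun n => (s n).toPair) hs
    (fun A hA => by
      obtain ⟨n, T, rfl⟩ := hsat A hA
      refine ⟨n, (s n).σ.symm ⁻¹' T, ?_⟩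
      ext x
      simp [PeriodicPartition.toPair])
    hsat
  have hgs : ∀ n, (s n).p ∘ g = (s n).σ ∘ (s n).p := hgs
  refine ⟨g, hg, ⟨fun l r => ?_, fun k l d hd => ?_⟩, h0 ▸ hgs 0⟩
  · obtain ⟨n, ρ, hρ⟩ := hD (.inl ⟨l, r⟩)
    have := (s n).finite
    let e := Finite.equivFin (s n).κ
    refine ⟨_, ⟨e ∘ (s n).p, (s n).isLocallyConstant.comp e⟩, e.permCongr (s n).σ, ρ ∘ e.symm,
      ?_, ?_⟩
    · funext x
      have := congrFun (hgs n) x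
      simp only [Function.comp_apply] at this
      simp [Equiv.permCongr_apply, this]
    · refine Eq.trans hρ ?_
      funext x
      simp
  · obtain ⟨n, ⟨ρ, hρ⟩, h⟩ := hD (.inr ⟨(k, l), d⟩)
    obtain ⟨θ, h1, h2, h3⟩ := h ρ hρ fun x => by
      have e1 := congrFun hd x
      have e2 := congrFun (hgs n) x
      rw [hρ] at e1
      simp only [Function.comp_apply] at e1 e2
      rw [← e2, e1]
    refine ⟨⟨θ ∘ (s n).p, (s n).isLocallyConstant.comp θ⟩, ?_, h2, h3⟩
    change θ ∘ ((s n).p ∘ g) = d.τ ∘ θ ∘ (s n).p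
    rw [hgs, h1]

end IsGeneric

theorem hasStrongRokhlin_of_divisible (hμ : IsGood μ)
    (hv : clopenValues μ = (H : Set ℝ) ∩ Icc 0 1)
    (hdiv : ∀ h ∈ H, ∀ n : ℕ, n ≠ 0 → h / n ∈ H) : HasStrongRokhlin (Homeo μ) := by
  have hdense : Dense {g : Homeo μ | IsGeneric μ g.1} := by
    -- Approximate `g` by a permuted partition and realize that by a generic homeomorphism.
    refine dense_iff_inter_open.2 fun O hO ⟨g, hg⟩ => ?_
    obtain ⟨ι, _, p, hp, hsub⟩ := Homeo.exists_comp_eq_subset hO hg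
    obtain ⟨Q, ρ, h1, h2⟩ := PeriodicPartition.exists_approx hμ hv g.2 hp
    obtain ⟨f, hf, hfg, hfQ⟩ := IsGeneric.exists_isGeneric hμ hv hdiv Q
    refine ⟨⟨f, hf⟩, hsub ?_, hfg⟩
    change p ∘ f = p ∘ g.1
    rw [h2, ← hfQ, h1]
    rfl
  obtain ⟨g, hg⟩ := hdense.nonempty
  have hconj : conjugatesOf g = {g : Homeo μ | IsGeneric μ g.1} := by
    ext h
    change IsConj g h ↔ _
    rw [isConj_iff]
    constructor
    · rintro ⟨c, rfl⟩
      exact IsGeneric.conj hg c.2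
    · intro hh
      obtain ⟨f, hf, hfg⟩ := IsGeneric.exists_conj hμ hv hg g.2 hh h.2
      refine ⟨⟨f, hf⟩, Subtype.ext ?_⟩
      change f * g.1 * f⁻¹ = h.1
      rw [hfg, mul_inv_cancel_right]
  exact ⟨g, hconj ▸ hdense, hconj ▸ isGδ_isGeneric⟩

end Generic

/-! ### The obstruction to a dense conjugacy class. -/

section NotRokhlin

variable {μ : Measure Cantor} {H : AddSubgroup ℝ}

/-- If the Cantor space splits into `n` pieces of equal measure, but a clopen set of measure `β`
does not, then cyclic permutations of the pieces and homeomorphisms preserving a clopen set of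
measure `β` have no common limits of conjugates. -/
theorem not_hasRokhlin_of_div_notMem (hμ : IsGood μ)
    (hv : clopenValues μ = (H : Set ℝ) ∩ Icc 0 1) {n : ℕ} (hn : n ≠ 0) (hnH : (1 / n : ℝ) ∈ H)
    {β : ℝ} (hβ : β ∈ H) (hβ0 : 0 ≤ β) (hβ1 : β ≤ 1) (hβn : β / n ∉ H) :
    ¬ HasRokhlin (Homeo μ) := by
  classical
  have := hμ.isProbabilityMeasure
  have : NeZero n := ⟨hn⟩
  have hn' : (n : ℝ) ≠ 0 := Nat.cast_ne_zero.2 hn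
  obtain ⟨q, hq, -, hqw⟩ := hμ.exists_refinement hv (IsLocallyConstant.const ())
    (fun _ : ZMod n => ()) (fun _ => (1 / n : ℝ)) (fun _ => by positivity) (fun _ => hnH)
    (fun i => by
      have : (Function.const Cantor ()) ⁻¹' {i} = univ := by ext; simp
      rw [this]
      simp [hn'])
  let P : PeriodicPartition μ :=
    ⟨ZMod n, inferInstance, q, Equiv.addRight 1, hq, fun j => by rw [hqw, hqw]⟩
  have : Finite P.toPair.κ := P.finite
  obtain ⟨h₀, hh₀, hq₀⟩ := hμ.exists_homeo_comp_eq hv P.toPair.isLocallyConstant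
    P.toPair.isLocallyConstant' P.toPair.real_eq
  obtain ⟨B, hB, hBβ⟩ : β ∈ clopenValues μ := by rw [hv]; exact ⟨hβ, hβ0, hβ1⟩
  have hBlc := isLocallyConstant_mem hB
  rintro ⟨g, hg⟩
  obtain ⟨g₁, h1, hc1⟩ := dense_iff_inter_open.1 hg _
    (Homeo.isOpen_setOf_comp_eq hq (hq.comp (· + 1))) ⟨⟨h₀, hh₀⟩, hq₀⟩
  -- The open set of homeomorphisms preserving `B` contains the identity.
  obtain ⟨g₂, h2, hc2⟩ := dense_iff_inter_open.1 hg _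
    (Homeo.isOpen_setOf_comp_eq hBlc hBlc) ⟨1, rfl⟩
  have hc1 : IsConj g g₁ := hc1
  have hc2 : IsConj g g₂ := hc2
  obtain ⟨c, hc⟩ := isConj_iff.1 (hc1.symm.trans hc2)
  have h1 : ∀ x, q (g₁.1 x) = q x + 1 := congrFun h1
  have h2 : ∀ x, (g₂.1 x ∈ B) = (x ∈ B) := congrFun h2
  have hcg : ∀ x, c.1 (g₁.1 x) = g₂.1 (c.1 x) := fun x =>
    congrArg (fun h : Homeo μ => h.1 x) (mul_inv_eq_iff_eq_mul.1 hc)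
  -- The preimage of `B` under `c` is invariant under `g₁`, which moves its part in piece `k` onto
  -- its part in piece `k + 1`; hence all `n` parts have equal measure.
  let r : Cantor → Prop × ZMod n := fun x => (c.1 x ∈ B, q x)
  have hr : IsLocallyConstant r :=
    (isLocallyConstant_mem (hB.preimage c.1.continuous)).prodMk hq
  have hstep : ∀ k, μ.real (r ⁻¹' {(True, k + 1)}) = μ.real (r ⁻¹' {(True, k)}) := by
    intro k
    rw [← Homeo.real_preimage g₁.2 (hr.measurableSet_preimage _)]
    congr 1
    ext x
    simp [r, hcg, h1, h2]
  have hconst : ∀ k : ℕ, μ.real (r ⁻¹' {(True, (k : ZMod n))}) = μ.real (r ⁻¹' {(True, 0)}) := by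
    intro k
    induction k with
    | zero => simp
    | succ k ih => rw [Nat.cast_succ, hstep, ih]
  have hsum : ∑ k, μ.real (r ⁻¹' {(True, k)}) = β := by
    rw [sum_real_fiber_fst hr, ← hBβ, ← Homeo.real_preimage c.2 hB.2.measurableSet]
    congr 1
    ext x
    simp [r]
  have hall : ∀ k : ZMod n, μ.real (r ⁻¹' {(True, k)}) = μ.real (r ⁻¹' {(True, 0)}) := fun k => by
    have := hconst k.val
    rwa [ZMod.natCast_zmod_val] at this
  refine hβn ?_
  have hval : β / n = μ.real (r ⁻¹' {(True, 0)}) := by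
    rw [div_eq_iff hn', ← hsum, Finset.sum_congr rfl fun k _ => hall k]
    simp [mul_comm]
  rw [hval]
  exact real_mem hv (hr.isClopen_fiber _)

end NotRokhlin

/-! ### Construction of good measures from interval subdivisions. -/

section Existence

/-- The first `n` digits of a point of the Cantor space. -/
def digits (n : ℕ) (s : Cantor) : Fin n → Bool := fun i => s i

theorem isLocallyConstant_digits (n : ℕ) : IsLocallyConstant (digits n) :=
  (IsLocallyConstant.iff_continuous _).2 (by unfold digits; fun_prop)

theorem digits_eq_of_le {m n : ℕ} (h : m ≤ n) {s t : Cantor} (hst : digits n s = digits n t) :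
    digits m s = digits m t :=
  funext fun i => congrFun hst (Fin.castLE h i)

theorem exists_digits_subset {U : Set Cantor} (hU : IsOpen U) {s : Cantor} (hs : s ∈ U) :
    ∃ n, ∀ t, digits n t = digits n s → t ∈ U := by
  obtain ⟨_, ⟨x, n, rfl⟩, hsx, hxU⟩ :=
    (PiNat.isTopologicalBasis_cylinders fun _ => Bool).exists_subset_of_mem_open hs hU
  refine ⟨n, fun t ht => hxU fun i hi => ?_⟩
  rw [← hsx i hi]
  exact congrFun ht ⟨i, hi⟩

theorem exists_eq_preimage_digits {U : Set Cantor} (hU : IsClopen U) :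
    ∃ n, ∃ T : Set (Fin n → Bool), U = digits n ⁻¹' T := by
  let O : ℕ → Set Cantor := fun n => {s | ∀ t, digits n t = digits n s → (t ∈ U ↔ s ∈ U)}
  have hmono : Monotone O := fun m n hmn s hs t ht => hs t (digits_eq_of_le hmn ht)
  have hopen : ∀ n, IsOpen (O n) := by
    intro n
    refine isOpen_iff_forall_mem_open.2 fun s hs => ⟨digits n ⁻¹' {digits n s}, ?_,
      isLocallyConstant_digits n _, rfl⟩
    intro u hu t ht
    rw [hs t (ht.trans hu), hs u hu]
  obtain ⟨n, hn⟩ := isCompact_univ.elim_directed_cover O hopen (fun s _ => by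
    by_cases hs : s ∈ U
    · obtain ⟨n, hn⟩ := exists_digits_subset hU.2 hs
      exact mem_iUnion.2 ⟨n, fun t ht => iff_of_true (hn t ht) hs⟩
    · obtain ⟨n, hn⟩ := exists_digits_subset hU.compl.2 hs
      exact mem_iUnion.2 ⟨n, fun t ht => iff_of_false (hn t ht) hs⟩) hmono.directed_le
  refine ⟨n, digits n '' U, (subset_preimage_image _ _).antisymm ?_⟩
  rintro s ⟨t, ht, hts⟩
  exact (hn (mem_univ s) t hts).1 ht

variable {H : AddSubgroup ℝ} (cut : ℕ → H → H → H)

/-- Replace an interval by its left or right part with respect to its cut point. -/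
noncomputable def nextCell (n : ℕ) (c : H × H) (b : Bool) : H × H :=
  if b then (cut n c.1 c.2, c.2) else (c.1, cut n c.1 c.2)

/-- The endpoints of the interval with a given binary address. -/
noncomputable def cell (u : H) (s : Cantor) : ℕ → H × H
  | 0 => (0, u)
  | n + 1 => nextCell cut n (cell u s n) (s n)

open Classical in
/-- The endpoints of the interval of a given generation that contains a given point. -/
noncomputable def cellOf (u : H) (x : ℝ) : ℕ → H × H
  | 0 => (0, u)
  | n + 1 => nextCell cut n (cellOf u x n)
      (decide ((cut n (cellOf u x n).1 (cellOf u x n).2 : ℝ) ≤ x))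

open Classical in
/-- The binary address of a point. -/
noncomputable def address (u : H) (x : ℝ) : Cantor := fun n =>
  decide ((cut n (cellOf cut u x n).1 (cellOf cut u x n).2 : ℝ) ≤ x)

theorem measurable_address [Countable H] (u : H) : Measurable (address cut u) := by
  classical
  have hstep : ∀ n, Measurable fun z : ℝ × (H × H) => decide ((cut n z.2.1 z.2.2 : ℝ) ≤ z.1) := by
    intro n
    refine measurable_from_prod_countable_left fun c => ?_
    refine measurable_to_bool ?_
    convert measurableSet_Ici (a := (cut n c.1 c.2 : ℝ)) using 1
    ext x
    simp
  have hcell : ∀ n, Measurable fun x => cellOf cut u x n := by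
    intro n
    induction n with
    | zero => exact measurable_const
    | succ n ih =>
      have h1 : Measurable fun z : (H × H) × Bool => nextCell cut n z.1 z.2 :=
        measurable_from_prod_countable_left fun b => measurable_of_countable _
      exact h1.comp (ih.prodMk ((hstep n).comp (measurable_id.prodMk ih)))
  exact measurable_pi_iff.2 fun n => (hstep n).comp (measurable_id.prodMk (hcell n))

variable {cut} {u : H}

theorem cellOf_eq (x : ℝ) (n : ℕ) : cellOf cut u x n = cell cut u (address cut u x) n := by
  induction n with
  | zero => rfl
  | succ n ih => rw [cellOf, cell, ← ih]; rfl

theorem cell_congr {s t : Cantor} {n : ℕ} (h : digits n s = digits n t) :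
    cell cut u s n = cell cut u t n := by
  induction n with
  | zero => rfl
  | succ n ih =>
    rw [cell, cell, ih (digits_eq_of_le n.le_succ h)]
    congr 1
    exact congrFun h (Fin.last n)

theorem mem_cell_address {x : ℝ} (hx : x ∈ Ico (0 : ℝ) u) (n : ℕ) :
    x ∈ Ico ((cell cut u (address cut u x) n).1 : ℝ) (cell cut u (address cut u x) n).2 := by
  induction n with
  | zero => simpa [cell] using hx
  | succ n ih =>
    have haddr : address cut u x n = true ↔ (cut n (cell cut u (address cut u x) n).1
        (cell cut u (address cut u x) n).2 : ℝ) ≤ x := by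
      rw [← cellOf_eq]; simp [address]
    rw [cell, nextCell]
    split_ifs with h
    · exact ⟨haddr.1 h, ih.2⟩
    · exact ⟨ih.1, lt_of_not_ge fun hle => h (haddr.2 hle)⟩

variable (hcut : ∀ n x y, x < y → x < cut n x y ∧ cut n x y < y)

include hcut

theorem cell_lt (hu : 0 < u) (s : Cantor) (n : ℕ) : (cell cut u s n).1 < (cell cut u s n).2 := by
  induction n with
  | zero => exact hu
  | succ n ih =>
    rw [cell, nextCell]
    split_ifs
    · exact (hcut n _ _ ih).2
    · exact (hcut n _ _ ih).1

theorem cell_succ (hu : 0 < u) (s : Cantor) (n : ℕ) :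
    (cell cut u s n).1 ≤ (cell cut u s (n + 1)).1 ∧
      (cell cut u s (n + 1)).2 ≤ (cell cut u s n).2 := by
  have h := hcut n _ _ (cell_lt hcut hu s n)
  rw [cell, nextCell]
  split_ifs
  · exact ⟨h.1.le, le_rfl⟩
  · exact ⟨le_rfl, h.2.le⟩

theorem digits_address_of_mem_cell (hu : 0 < u) {s : Cantor} {x : ℝ} (n : ℕ)
    (hx : x ∈ Ico ((cell cut u s n).1 : ℝ) (cell cut u s n).2) :
    x ∈ Ico (0 : ℝ) u ∧ digits n (address cut u x) = digits n s := by
  induction n with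
  | zero => exact ⟨by simpa [cell] using hx, funext fun i => i.elim0⟩
  | succ n ih =>
    have hsucc := cell_succ hcut hu s n
    obtain ⟨hx0, hd⟩ := ih ⟨le_trans (Subtype.coe_le_coe.2 hsucc.1) hx.1,
      hx.2.trans_le (Subtype.coe_le_coe.2 hsucc.2)⟩
    refine ⟨hx0, funext fun i => ?_⟩
    refine Fin.lastCases ?_ (fun i => ?_) i
    · have haddr : address cut u x n = true ↔
          (cut n (cell cut u s n).1 (cell cut u s n).2 : ℝ) ≤ x := by
        rw [← cell_congr hd, ← cellOf_eq]; simp [address]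
      change address cut u x n = s n
      rw [Bool.eq_iff_iff, haddr]
      rw [cell, nextCell] at hx
      split_ifs at hx with h
      · exact iff_of_true hx.1 h
      · exact iff_of_false (not_le.2 hx.2) h
    · exact congrFun hd i

/-- Cylinders correspond to half-open cells, so their measures are lengths. -/
theorem address_mem_iff (hu : 0 < u) (s : Cantor) (n : ℕ) :
    address cut u ⁻¹' (digits n ⁻¹' {digits n s}) ∩ Ico (0 : ℝ) u =
      Ico ((cell cut u s n).1 : ℝ) (cell cut u s n).2 := by
  ext x
  constructor
  · rintro ⟨h, hx⟩
    rw [← cell_congr h]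
    exact mem_cell_address hx n
  · intro hx
    obtain ⟨h1, h2⟩ := digits_address_of_mem_cell hcut hu n hx
    exact ⟨h2, h1⟩

/-- At stage `m` any cell with `v` in its interior is cut at `v`, and later cells only shrink. -/
theorem not_mem_cell_of_cut (hu : 0 < u) {v : H} {m : ℕ} (hv : ∀ x y, x < v → v < y → cut m x y = v)
    (s : Cantor) {n : ℕ} (hn : m < n) : ¬ ((cell cut u s n).1 < v ∧ v < (cell cut u s n).2) := by
  induction n, hn using Nat.le_induction with
  | base =>
    rintro ⟨h1, h2⟩
    have h := cell_succ hcut hu s m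
    have hc := hv _ _ (h.1.trans_lt h1) (h2.trans_le h.2)
    rw [cell, nextCell, hc] at h1 h2
    split_ifs at h1 h2
    · exact lt_irrefl _ h1
    · exact lt_irrefl _ h2
  | succ n _ ih =>
    rintro ⟨h1, h2⟩
    have h := cell_succ hcut hu s n
    exact ih ⟨h.1.trans_lt h1, h2.trans_le h.2⟩

omit hcut

/-- The image of Lebesgue measure on the unit interval under the address map. -/
noncomputable def addressMeasure (cut : ℕ → H → H → H) (u : H) : Measure Cantor :=
  (volume.restrict (Ico (0 : ℝ) u)).map (address cut u)

theorem addressMeasure_real [Countable H] {A : Set Cantor} (hA : MeasurableSet A) :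
    (addressMeasure cut u).real A = volume.real (address cut u ⁻¹' A ∩ Ico (0 : ℝ) u) := by
  rw [addressMeasure, map_measureReal_apply (measurable_address cut u) hA,
    measureReal_restrict_apply (measurable_address cut u hA)]

include hcut

theorem addressMeasure_real_cylinder [Countable H] (hu : 0 < u) (s : Cantor) (n : ℕ) :
    (addressMeasure cut u).real (digits n ⁻¹' {digits n s}) =
      ((cell cut u s n).2 - (cell cut u s n).1 : ℝ) := by
  rw [addressMeasure_real ((isLocallyConstant_digits n).measurableSet_preimage _),
    address_mem_iff hcut hu, Real.volume_real_Ico_of_le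
      (Subtype.coe_le_coe.2 (cell_lt hcut hu s n).le)]

theorem exists_isClopen_subset_cylinder [Countable H] (hu : 0 < u)
    (hdense : ∀ v : H, ∃ m, ∀ x y, x < v → v < y → cut m x y = v) (s : Cantor) (n : ℕ) (h : H)
    (h0 : 0 ≤ h) (hle : (h : ℝ) ≤ (addressMeasure cut u).real (digits n ⁻¹' {digits n s})) :
    ∃ W, IsClopen W ∧ W ⊆ digits n ⁻¹' {digits n s} ∧ (addressMeasure cut u).real W = h := by
  rw [addressMeasure_real_cylinder hcut hu] at hle
  set L := (cell cut u s n).1 with hL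
  set U := (cell cut u s n).2 with hU
  have h0' : (0 : ℝ) ≤ h := h0
  obtain ⟨m, hm⟩ := hdense (L + h)
  -- By generation `m + 1` the point `L + h` is interior to no cell, so the left part of length `h`
  -- of the given cell is a union of cells of generation `N`.
  let N := max n (m + 1)
  let W : Set Cantor := {t | digits n t = digits n s ∧ (cell cut u t N).2 ≤ L + h}
  have hW : IsClopen W := by
    have : W = digits N ⁻¹' (digits N '' W) := by
      refine (subset_preimage_image _ _).antisymm ?_
      rintro t ⟨t', ⟨ht1, ht2⟩, htt⟩
      exact ⟨(digits_eq_of_le (le_max_left _ _) htt).symm.trans ht1, by rwa [← cell_congr htt]⟩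
    rw [this]
    exact (isLocallyConstant_digits N).isClopen_preimage _
  refine ⟨W, hW, fun t ht => ht.1, ?_⟩
  have hpre : address cut u ⁻¹' W ∩ Ico (0 : ℝ) u = Ico (L : ℝ) (L + h) := by
    have key : ∀ x ∈ Ico (0 : ℝ) u,
        ((cell cut u (address cut u x) N).2 ≤ L + h ↔ x < (L + h : ℝ)) := by
      intro x hx
      have hc := mem_cell_address (cut := cut) hx N
      constructor
      · intro hle'
        exact hc.2.trans_le (by exact_mod_cast hle')
      · intro hlt
        by_contra hlt'
        exact not_mem_cell_of_cut hcut hu hm (address cut u x) (n := N)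
          (Nat.lt_of_succ_le (le_max_right _ _))
          ⟨by
            have := hc.1.trans_lt hlt
            exact_mod_cast this, not_le.1 hlt'⟩
    have hcyl := address_mem_iff hcut hu s n
    ext x
    have hx : (x ∈ address cut u ⁻¹' (digits n ⁻¹' {digits n s}) ∩ Ico (0 : ℝ) u) ↔
      x ∈ Ico (L : ℝ) U := by rw [hcyl]
    constructor
    · rintro ⟨⟨h1, h2⟩, hx0⟩
      exact ⟨(hx.1 ⟨h1, hx0⟩).1, (key x hx0).1 h2⟩
    · rintro ⟨h1, h2⟩
      obtain ⟨h3, hx0⟩ := hx.2 ⟨h1, by linarith⟩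
      exact ⟨⟨h3, (key x hx0).2 h2⟩, hx0⟩
  rw [addressMeasure_real hW.2.measurableSet, hpre, Real.volume_real_Ico_of_le (by linarith)]
  ring

theorem addressMeasure_real_mem [Countable H] (hu : 0 < u) {A : Set Cantor} (hA : IsClopen A) :
    (addressMeasure cut u).real A ∈ H := by
  classical
  have : IsFiniteMeasure (addressMeasure cut u) := by unfold addressMeasure; infer_instance
  obtain ⟨n, T, rfl⟩ := exists_eq_preimage_digits hA
  have h : digits n ⁻¹' T = digits n ⁻¹' ((Finset.univ.filter (· ∈ T) : Finset (Fin n → Bool))) := by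
    ext s; simp
  rw [h, ← sum_measureReal_preimage_singleton _
    fun y _ => (isLocallyConstant_digits n).measurableSet_preimage _]
  refine H.sum_mem fun t _ => ?_
  rcases (digits n ⁻¹' {t}).eq_empty_or_nonempty with he | ⟨s, rfl⟩
  · rw [he]; simp
  · rw [addressMeasure_real_cylinder hcut hu]
    exact H.sub_mem (Subtype.prop _) (Subtype.prop _)

/-- Either the remaining cylinders suffice, or they are taken whole and the deficit, again in `H`,
is cut from the cylinder of `t`. -/
theorem exists_isClopen_subset_of_le [Countable H] (hu : 0 < u)
    (hdense : ∀ v : H, ∃ m, ∀ x y, x < v → v < y → cut m x y = v) {n : ℕ}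
    (T : Finset (Fin n → Bool)) : ∀ h : H, 0 ≤ h →
      (h : ℝ) ≤ (addressMeasure cut u).real (digits n ⁻¹' T) →
      ∃ W, IsClopen W ∧ W ⊆ digits n ⁻¹' T ∧ (addressMeasure cut u).real W = h := by
  classical
  have : IsFiniteMeasure (addressMeasure cut u) := by unfold addressMeasure; infer_instance
  induction T using Finset.induction_on with
  | empty =>
    intro h h0 hle
    have h0' : (0 : ℝ) ≤ h := h0
    refine ⟨∅, isClopen_empty, empty_subset _, ?_⟩
    simp at hle ⊢
    linarith
  | insert t T ht ih =>
    intro h h0 hle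
    have hsub : digits n ⁻¹' T ⊆ digits n ⁻¹' (insert t T : Finset (Fin n → Bool)) :=
      preimage_mono (by simp)
    have hT := (isLocallyConstant_digits n).isClopen_preimage (T : Set (Fin n → Bool))
    rcases le_total (h : ℝ) ((addressMeasure cut u).real (digits n ⁻¹' T)) with hhT | hhT
    · obtain ⟨W, hW, hWT, hWh⟩ := ih h h0 hhT
      exact ⟨W, hW, hWT.trans hsub, hWh⟩
    · have hdisj : Disjoint (digits n ⁻¹' {t}) (digits n ⁻¹' (T : Set (Fin n → Bool))) :=
        Disjoint.preimage _ (by simpa using ht)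
      have hun : digits n ⁻¹' (insert t T : Finset (Fin n → Bool)) =
          digits n ⁻¹' {t} ∪ digits n ⁻¹' T := by
        rw [Finset.coe_insert, insert_eq, preimage_union]
      rw [hun, measureReal_union hdisj hT.2.measurableSet] at hle
      let s : Cantor := fun i => if hi : i < n then t ⟨i, hi⟩ else false
      have hs : digits n s = t := by
        funext i; simp [digits, s]
      have hH := addressMeasure_real_mem hcut hu hT
      rw [← hs] at hle hdisj hun
      obtain ⟨W, hW, hWs, hWh⟩ := exists_isClopen_subset_cylinder hcut hu hdense s n
        (h - ⟨_, hH⟩) (sub_nonneg.2 (Subtype.coe_le_coe.1 hhT))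
        (by rw [AddSubgroup.coe_sub]; simp only; linarith)
      refine ⟨W ∪ digits n ⁻¹' T, hW.union hT, ?_, ?_⟩
      · rw [← hs, hun]
        exact union_subset_union_left _ hWs
      · rw [measureReal_union (hdisj.mono_left hWs) hT.2.measurableSet, hWh, AddSubgroup.coe_sub]
        simp

omit hcut

theorem exists_isGood (H : AddSubgroup ℝ) (hc : (H : Set ℝ).Countable)
    (hd : ∀ x y : ℝ, x < y → ∃ h ∈ H, x < h ∧ h < y) (h1 : (1 : ℝ) ∈ H) :
    ∃ μ, IsGood μ ∧ clopenValues μ = (H : Set ℝ) ∩ Icc 0 1 := by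
  classical
  have : Countable H := hc.to_subtype
  obtain ⟨v, hv⟩ := exists_surjective_nat H
  have hmid : ∀ x y : H, ∃ z : H, x < y → x < z ∧ z < y := by
    intro x y
    by_cases hxy : x < y
    · obtain ⟨h, hh, h'⟩ := hd x y hxy
      exact ⟨⟨h, hh⟩, fun _ => h'⟩
    · exact ⟨0, fun h => absurd h hxy⟩
  choose mid hmid using hmid
  -- The `n`-th element of an enumeration of `H` is the cut point whenever it is interior; otherwise
  -- any interior element of `H` will do.
  let cut : ℕ → H → H → H := fun n x y => if x < v n ∧ v n < y then v n else mid x y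
  have hcut : ∀ n x y, x < y → x < cut n x y ∧ cut n x y < y := by
    intro n x y hxy
    by_cases h : x < v n ∧ v n < y
    · simpa only [cut, if_pos h] using h
    · simpa only [cut, if_neg h] using hmid x y hxy
  have hdense : ∀ w : H, ∃ m, ∀ x y, x < w → w < y → cut m x y = w := by
    intro w
    obtain ⟨m, rfl⟩ := hv w
    exact ⟨m, fun x y hx hy => if_pos ⟨hx, hy⟩⟩
  let u : H := ⟨1, h1⟩
  have hu : 0 < u := Subtype.coe_lt_coe.1 (by simp [u])
  let μ := addressMeasure cut u
  have hprob : IsProbabilityMeasure μ := by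
    have : IsProbabilityMeasure (volume.restrict (Ico (0 : ℝ) u)) := ⟨by simp [u]⟩
    exact Measure.isProbabilityMeasure_map (measurable_address cut u).aemeasurable
  have hsub : ∀ A : Set Cantor, IsClopen A → ∀ h : H, 0 ≤ h → (h : ℝ) ≤ μ.real A →
      ∃ W, IsClopen W ∧ W ⊆ A ∧ μ.real W = h := by
    intro A hA h h0 hle
    obtain ⟨n, T, rfl⟩ := exists_eq_preimage_digits hA
    have hT : T = ((Finset.univ.filter (· ∈ T) : Finset (Fin n → Bool)) : Set (Fin n → Bool)) := by
      ext; simp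
    rw [hT] at hle ⊢
    exact exists_isClopen_subset_of_le hcut hu hdense _ h h0 hle
  refine ⟨μ, ⟨hprob, fun U hU ⟨s, hs⟩ => ?_, fun U V hU hV hUV => ?_⟩, ?_⟩
  · obtain ⟨n, hn⟩ := exists_digits_subset hU hs
    refine lt_of_lt_of_le ?_ (measure_mono (s := digits n ⁻¹' {digits n s}) fun t ht => hn t ht)
    rw [pos_iff_ne_zero, ← measureReal_ne_zero_iff]
    rw [addressMeasure_real_cylinder hcut hu]
    exact (sub_pos.2 (Subtype.coe_lt_coe.2 (cell_lt hcut hu s n))).ne'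
  · obtain ⟨W, hW, hWV, hWU⟩ := hsub V hV ⟨μ.real U, addressMeasure_real_mem hcut hu hU⟩
      (Subtype.coe_le_coe.1 measureReal_nonneg)
      ((ENNReal.toReal_le_toReal (measure_ne_top _ _) (measure_ne_top _ _)).2 hUV.le)
    exact ⟨W, hW, hWV, (measureReal_eq_measureReal_iff).1 hWU⟩
  · ext r
    constructor
    · rintro ⟨U, hU, rfl⟩
      exact ⟨addressMeasure_real_mem hcut hu hU, measureReal_nonneg, measureReal_le_one⟩
    · rintro ⟨hr, h0, hr1⟩
      obtain ⟨W, hW, -, hWr⟩ := hsub univ isClopen_univ ⟨r, hr⟩ (Subtype.coe_le_coe.1 h0)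
        (by simpa using hr1)
      exact ⟨W, hW, hWr⟩

end Existence

/-! ### From group-like sets to dense subgroups. -/

section GroupLike

variable {V : Set ℝ}

theorem GroupLike.exists_addSubgroup (hV : GroupLike V) : ∃ G : AddSubgroup ℝ,
    (G : Set ℝ) = addInt V ∧ V = (G : Set ℝ) ∩ Icc 0 1 ∧ (1 : ℝ) ∈ G ∧ (G : Set ℝ).Countable ∧
      ∀ x y : ℝ, x < y → ∃ h ∈ G, x < h ∧ h < y := by
  obtain ⟨G, hG⟩ := hV.isAddSubgroup
  have hVG : V ⊆ G := fun v hv => hG ▸ ⟨v, hv, 0, by simp⟩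
  have hV' : V = (G : Set ℝ) ∩ Icc 0 1 := by
    refine Subset.antisymm (fun v hv => ⟨hVG hv, hV.subset_Icc hv⟩) ?_
    rintro x ⟨hx, h0, h1⟩
    rw [hG] at hx
    obtain ⟨v, hv, k, rfl⟩ := hx
    obtain ⟨hv0, hv1⟩ := hV.subset_Icc hv
    have hk1 : (k : ℝ) ≤ (1 : ℤ) := by push_cast; linarith
    have hk2 : ((-1 : ℤ) : ℝ) ≤ k := by push_cast; linarith
    have hk1 := Int.cast_le.1 hk1
    have hk2 := Int.cast_le.1 hk2
    obtain rfl | rfl | rfl : k = -1 ∨ k = 0 ∨ k = 1 := by omega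
    · have : v = 1 := by push_cast at h0; linarith
      simpa [this] using hV.zero_mem
    · simpa using hv
    · have : v = 0 := by push_cast at h1; linarith
      simpa [this] using hV.one_mem
  have h1 : (1 : ℝ) ∈ G := hVG hV.one_mem
  have hdense : Dense (G : Set ℝ) := by
    -- A cyclic subgroup containing 1 meets `[0,1]` in a finite set, while `V` is infinite.
    refine G.dense_or_cyclic.resolve_right ?_
    rintro ⟨a, ha⟩
    refine hV.infinite ?_
    have hmem : ∀ x, x ∈ G ↔ ∃ k : ℤ, k • a = x := fun x => by
      rw [ha, AddSubgroup.mem_closure_singleton]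
    have ha0 : a ≠ 0 := by
      rintro rfl
      obtain ⟨k, hk⟩ := (hmem 1).1 h1
      simp at hk
    have ha0' : 0 < |a| := abs_pos.2 ha0
    refine ((finite_Icc (-⌈1 / |a|⌉) ⌈1 / |a|⌉).image fun k : ℤ => k • a).subset fun x hx => ?_
    obtain ⟨k, rfl⟩ := (hmem x).1 (hVG hx)
    refine ⟨k, abs_le.1 ((Int.cast_le (R := ℝ)).1 ?_), rfl⟩
    refine le_trans ?_ (Int.le_ceil _)
    rw [Int.cast_abs, le_div_iff₀ ha0', ← abs_mul, ← zsmul_eq_mul]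
    obtain ⟨hx0, hx1⟩ := hV.subset_Icc hx
    exact abs_le.2 ⟨by linarith, hx1⟩
  refine ⟨G, hG, hV', h1, ?_, fun x y hxy => ?_⟩
  · rw [hG]
    refine ((hV.countable.prod (countable_univ (α := ℤ))).image fun z => z.1 + z.2).mono ?_
    rintro x ⟨v, hv, k, rfl⟩
    exact ⟨(v, k), ⟨hv, mem_univ _⟩, rfl⟩
  · obtain ⟨h, hh, hxh⟩ := hdense.exists_mem_open isOpen_Ioo (nonempty_Ioo.2 hxy)
    exact ⟨h, hh, hxh⟩

/-- The group `G / a`. -/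
def divGroup (G : AddSubgroup ℝ) (a : ℝ) : AddSubgroup ℝ := G.comap (AddMonoidHom.mulLeft a)

theorem mem_divGroup {G : AddSubgroup ℝ} {a x : ℝ} : x ∈ divGroup G a ↔ a * x ∈ G := Iff.rfl

theorem scaled_eq {G : AddSubgroup ℝ} {a : ℝ} (ha0 : 0 < a) (ha1 : a ≤ 1) :
    scaled ((G : Set ℝ) ∩ Icc 0 1) a = (divGroup G a : Set ℝ) ∩ Icc 0 1 := by
  ext x
  constructor
  · rintro ⟨⟨v, ⟨hv, -⟩, rfl⟩, hx⟩
    refine ⟨?_, hx⟩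
    change a * (v / a) ∈ G
    rwa [mul_div_cancel₀ _ ha0.ne']
  · rintro ⟨hx, h0, h1⟩
    exact ⟨⟨a * x, ⟨hx, by positivity, by nlinarith⟩, by field_simp⟩, h0, h1⟩

theorem not_hasRokhlin_scaled {G : AddSubgroup ℝ} {a b : ℝ} {n : ℕ} (hn : 1 < n) (ha : a ∈ G)
    (hb : b ∈ G) (hb0 : 0 ≤ b) (hbn : b / n ∉ G) (hba : b / n ≤ a) (han : a ≤ 1 / n)
    {μ : Measure Cantor} (hμ : IsGood μ)
    (hv : clopenValues μ = scaled ((G : Set ℝ) ∩ Icc 0 1) (n * a)) : ¬ HasRokhlin (Homeo μ) := by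
  have hn0 : (0 : ℝ) < n := by positivity
  have ha0 : 0 < a := lt_of_le_of_ne (le_trans (by positivity) hba) fun h => by
    subst h
    rw [div_le_iff₀ hn0, zero_mul] at hba
    rw [le_antisymm hba hb0, zero_div] at hbn
    exact hbn ha
  have hna : (n : ℝ) * a ≤ 1 := by rwa [mul_comm, ← le_div_iff₀ hn0]
  have hbna : b ≤ n * a := by rwa [mul_comm, ← div_le_iff₀ hn0]
  rw [scaled_eq (by positivity) hna] at hv
  -- Multiplied by `n * a`, the numbers `1/n`, `β` and `β/n` become `a`, `b` and `b/n`.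
  refine not_hasRokhlin_of_div_notMem hμ hv (n := n) (by omega) (β := b / (n * a)) ?_ ?_
    (by positivity) (div_le_one_of_le₀ hbna (by positivity)) ?_
  · rw [mem_divGroup]
    convert ha using 1
    field_simp
  · rw [mem_divGroup]
    convert hb using 1
    field_simp
  · rw [mem_divGroup]
    convert hbn using 2
    field_simp

/-- A subgroup closed under division by positive integers is a rational subspace. -/
theorem exists_div_notMem_of_not_qLike (hV : GroupLike V) (hQ : ¬ QLike V) {G : AddSubgroup ℝ}
    (hG : (G : Set ℝ) = addInt V) : ∃ x ∈ G, ∃ n : ℕ, n ≠ 0 ∧ x / n ∉ G := by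
  by_contra! hdiv
  refine hQ ⟨hV, ⟨{ G with smul_mem' := fun c x hx => ?_ }, hG⟩⟩
  have h : c • x = c.num • (x / c.den) := by
    rw [Rat.smul_def, zsmul_eq_mul]
    nth_rewrite 1 [← Rat.num_div_den c]
    push_cast
    ring
  rw [h]
  exact G.zsmul_mem (hdiv x hx c.den c.den_nz) _

/-- A group that is not divisible has non-divisible elements in `[0, 1)`. -/
theorem exists_mem_Ico_div_notMem {G : AddSubgroup ℝ} (h1 : (1 : ℝ) ∈ G)
    (hd : ∀ x y : ℝ, x < y → ∃ h ∈ G, x < h ∧ h < y) {x : ℝ} (hx : x ∈ G) {n : ℕ}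
    (hxn : x / n ∉ G) : ∃ b ∈ G, 0 ≤ b ∧ b < 1 ∧ b / n ∉ G := by
  by_contra! hall
  -- As 1 itself is outside `[0,1)`, it is written as `y + (1 - y)`; integer parts of other elements
  -- are then harmless.
  have hone : (1 : ℝ) / n ∈ G := by
    obtain ⟨y, hy, hy0, hy1⟩ := hd 0 1 one_pos
    have := G.add_mem (hall y hy hy0.le hy1)
      (hall (1 - y) (G.sub_mem h1 hy) (by linarith) (by linarith))
    rwa [← add_div, add_sub_cancel] at this
  have hfloor : ∀ k : ℤ, (k : ℝ) ∈ G := fun k => by simpa using G.zsmul_mem h1 k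
  have hfract := hall (Int.fract x) (G.sub_mem hx (hfloor _)) (Int.fract_nonneg _)
    (Int.fract_lt_one _)
  have := G.add_mem hfract (G.zsmul_mem hone ⌊x⌋)
  rw [zsmul_eq_mul, mul_one_div, ← add_div, Int.fract_add_floor] at this
  exact hxn this

end GroupLike

end GoodMeasures

/-! ### The main theorem. -/

theorem mainTheorem8 (V : Set ℝ) (hV : GoodMeasures.GroupLike V) :
    -- the measures in question exist
    (∀ a ∈ V, a ≠ 0 → ∃ μ : Measure GoodMeasures.Cantor,
      GoodMeasures.IsGood μ ∧ GoodMeasures.clopenValues μ = GoodMeasures.scaled V a) ∧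
    -- the rational case
    (GoodMeasures.QLike V →
      ∀ a ∈ V, a ≠ 0 → ∀ μ : Measure GoodMeasures.Cantor, GoodMeasures.IsGood μ →
        GoodMeasures.clopenValues μ = GoodMeasures.scaled V a →
        GoodMeasures.HasStrongRokhlin (GoodMeasures.Homeo μ)) ∧
    -- the other case
    (¬ GoodMeasures.QLike V →
      (∀ ε : ℝ, 0 < ε → ∃ a ∈ V, 1 - ε < a ∧ a < 1 ∧ a ≠ 0 ∧
        ∀ μ : Measure GoodMeasures.Cantor, GoodMeasures.IsGood μ →
          GoodMeasures.clopenValues μ = GoodMeasures.scaled V a →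
          ¬ GoodMeasures.HasRokhlin (GoodMeasures.Homeo μ)) ∧
      (∀ b ∈ V, b < 1 → ∀ n : ℕ, 1 < n → b / n ∉ V →
        ∀ a ∈ V ∩ Icc (b / n) (1 / n), (n : ℝ) * a ∈ V ∧ (n : ℝ) * a ≠ 0 ∧
          ∀ μ : Measure GoodMeasures.Cantor, GoodMeasures.IsGood μ →
            GoodMeasures.clopenValues μ = GoodMeasures.scaled V (n * a) →
            ¬ GoodMeasures.HasRokhlin (GoodMeasures.Homeo μ))) := by
  obtain ⟨G, hGV, hVG, h1, hc, hd⟩ := hV.exists_addSubgroup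
  have hpos : ∀ a ∈ V, a ≠ 0 → 0 < a ∧ a ≤ 1 := fun a ha ha0 =>
    ⟨lt_of_le_of_ne (hV.subset_Icc ha).1 ha0.symm, (hV.subset_Icc ha).2⟩
  have hscaled : ∀ a ∈ V, a ≠ 0 → GoodMeasures.scaled V a =
      (GoodMeasures.divGroup G a : Set ℝ) ∩ Icc 0 1 := by
    intro a ha ha0
    obtain ⟨h0, h1⟩ := hpos a ha ha0
    conv_lhs => rw [hVG]
    exact GoodMeasures.scaled_eq h0 h1
  have hVsub : ∀ a ∈ V, a ∈ G := fun a ha => by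
    rw [hVG] at ha
    exact ha.1
  have hmem : ∀ (n : ℕ) (a : ℝ), 1 < n → a ∈ G → 0 ≤ a → a ≤ 1 / n → (n : ℝ) * a ∈ V := by
    intro n a hn ha ha0 han
    rw [hVG]
    refine ⟨by simpa using G.nsmul_mem ha n, by positivity, ?_⟩
    rwa [mul_comm, ← le_div_iff₀ (by positivity)]
  refine ⟨fun a ha ha0 => ?_, fun hQ a ha ha0 μ hμ hv => ?_, fun hQ => ⟨fun ε hε => ?_, ?_⟩⟩
  · rw [hscaled a ha ha0]
    obtain ⟨hapos, -⟩ := hpos a ha ha0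
    refine GoodMeasures.exists_isGood _ ?_ (fun x y hxy => ?_) ?_
    · exact hc.preimage (mul_right_injective₀ ha0)
    · obtain ⟨h, hh, hxh, hhy⟩ := hd (a * x) (a * y) (mul_lt_mul_of_pos_left hxy hapos)
      refine ⟨h / a, ?_, ?_, ?_⟩
      · rwa [GoodMeasures.mem_divGroup, mul_div_cancel₀ _ ha0]
      · rwa [lt_div_iff₀' hapos]
      · rwa [div_lt_iff₀' hapos]
    · rw [GoodMeasures.mem_divGroup, mul_one]
      exact hVsub a ha
  · rw [hscaled a ha ha0] at hv
    refine GoodMeasures.hasStrongRokhlin_of_divisible hμ hv fun h hh n hn => ?_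
    obtain ⟨W, hW⟩ := hQ.isRatSubspace
    have hWG : ∀ x, x ∈ W ↔ x ∈ G := fun x => by
      rw [← SetLike.mem_coe, hW, ← hGV, SetLike.mem_coe]
    rw [GoodMeasures.mem_divGroup] at hh ⊢
    have := W.smul_mem (1 / n : ℚ) ((hWG _).2 hh)
    rw [hWG, Rat.smul_def] at this
    convert this using 1
    push_cast
    ring
  · obtain ⟨x, hx, n, hn, hxn⟩ := GoodMeasures.exists_div_notMem_of_not_qLike hV hQ hGV
    obtain ⟨b, hb, hb0, hb1, hbn⟩ := GoodMeasures.exists_mem_Ico_div_notMem h1 hd hx hxn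
    have hn1 : 1 < n := by
      have : n ≠ 1 := by
        rintro rfl
        simp [hb] at hbn
      omega
    have hn0 : (0 : ℝ) < n := by positivity
    -- The required element is `n * a`: the lower bound keeps it above both `b` and `1 - ε`, the
    -- upper bound below 1.
    obtain ⟨a, ha, hba, han⟩ := hd (max (b / n) ((1 - ε) / n)) (1 / n)
      (max_lt (div_lt_div_of_pos_right hb1 hn0) (div_lt_div_of_pos_right (by linarith) hn0))
    obtain ⟨hba, hεa⟩ := max_lt_iff.1 hba
    have ha0 : 0 < a := lt_of_le_of_lt (by positivity) hba
    refine ⟨n * a, hmem n a hn1 ha ha0.le han.le, ?_, ?_, by positivity, fun μ hμ hv => ?_⟩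
    · rwa [← div_lt_iff₀' hn0]
    · rwa [← lt_div_iff₀' hn0]
    · rw [hVG] at hv
      exact GoodMeasures.not_hasRokhlin_scaled hn1 ha hb hb0 hbn hba.le han.le hμ hv
  · rintro b hb hb1 n hn hbn a ⟨ha, hba, han⟩
    have hn0 : (0 : ℝ) < n := by positivity
    have hb0 := (hV.subset_Icc hb).1
    have hbnG : b / n ∉ G := fun h => hbn <| by
      rw [hVG]
      refine ⟨h, by positivity, div_le_one_of_le₀ ?_ hn0.le⟩
      have : (1 : ℝ) ≤ n := by exact_mod_cast hn.le
      linarith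
    refine ⟨hmem n a hn (hVsub a ha) (hV.subset_Icc ha).1 han, fun h => ?_, fun μ hμ hv => ?_⟩
    · obtain rfl : a = 0 := (mul_eq_zero.1 h).resolve_left hn0.ne'
      refine hbn ?_
      rw [le_antisymm hba (by positivity)]
      exact ha
    · rw [hVG] at hv
      exact GoodMeasures.not_hasRokhlin_scaled hn (hVsub a ha) (hVsub b hb) hb0 hbnG hba han hμ hv
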